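/- Let $g:\mathbb{N}\to\mathbb{R}$ be strongly additive, i.e. $g(mn)=g(m)+g(n)$ whenever $\gcd(m,n)=1$ and $g(p^k)=g(p)$ for all primes $p$ and integers $k\ge 1$. For $n\ge 2$ let $\rho_n$ be the probability measure on $\mathbb{R}$ given, for Borel sets $A$, by $$\rho_n(A)=\frac{\sum_{p\le n,\ g(p)\in A}1/p}{\sum_{p\le n}1/p},$$ where here and below $p$ runs over primes. Assume that there is a probability measure $\rho$ on $\mathbb{R}$, different from the point mass $\delta_0$, such that for every $\theta\in\mathbb{R}$ we have $\int e^{\theta y}\,\rho(dy)<\infty$ and $\int e^{\theta y}\,\rho_n(dy)\to\int e^{\theta y}\,\rho(dy)$ as $n\to\infty$. Let $$\mu_n=\sum_{p\le n}\frac{g(p)}{p},\qquad \sigma_n^2=\sum_{p\le n}\frac{g(p)^2}{p}\quad(\sigma_n\ge 0),$$ and let $(a_n)$ be a sequence of positive real numbers with $\sigma_n\ll a_n\ll\sigma_n^2$, i.e. $\sigma_n=o(a_n)$ and $a_n=o(\sigma_n^2)$ as $n\to\infty$. Let $V(n)$ be uniformly distributed on $\{1,2,\dots,n\}$ and put $X(n)=g(V(n))$.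 Then the laws of $(X(n)-\mu_n)/a_n$ satisfy the large deviation principle on $\mathbb{R}$ with speed $a_n^2/\sigma_n^2$ and rate function $J(x)=x^2/2$; that is, $J$ is non-negative and lower semicontinuous, and for every Borel set $A\subset\mathbb{R}$, with interior $A^{o}$ and closure $\overline{A}$, $$-\inf_{x\in A^{o}}\frac{x^2}{2}\le\liminf_{n\to\infty}\frac{\sigma_n^2}{a_n^2}\log\mathbb{P}\left(\frac{X(n)-\mu_n}{a_n}\in A\right)\le\limsup_{n\to\infty}\frac{\sigma_n^2}{a_n^2}\log\mathbb{P}\left(\frac{X(n)-\mu_n}{a_n}\in A\right)\le-\inf_{x\in\overline{A}}\frac{x^2}{2},$$ where $\log 0=-\infty$ and the infimum over the empty set is $+\infty$. -/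

import Mathlib

open Filter Topology MeasureTheory ProbabilityTheory Asymptotics
open scoped ENNReal

namespace ErdosKac

/-- The sequence `P` of (probability) measures on `X` satisfies the large deviation principle with
speed `b` and rate function `I`. Logarithms are taken in the extended reals, so that `log 0 = -∞`,
and an infimum over the empty set is `+∞`. -/
structure SatisfiesLDP {X : Type*} [TopologicalSpace X] [MeasurableSpace X]
    (P : ℕ → Measure X) (b : ℕ → ℝ) (I : X → EReal) : Prop where
  nonneg : ∀ x, 0 ≤ I x
  lowerSemicontinuous : LowerSemicontinuous I
  lower : ∀ A : Set X, MeasurableSet A →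
    -(⨅ x ∈ interior A, I x) ≤ liminf (fun n => ENNReal.log (P n A) / (b n : EReal)) atTop
  upper : ∀ A : Set X, MeasurableSet A →
    limsup (fun n => ENNReal.log (P n A) / (b n : EReal)) atTop ≤ -(⨅ x ∈ closure A, I x)

/-- Strongly additive arithmetic functions. -/
structure StronglyAdditive (g : ℕ → ℝ) : Prop where
  prime_pow : ∀ p k : ℕ, p.Prime → 1 ≤ k → g (p ^ k) = g p
  mul : ∀ m n : ℕ, Nat.Coprime m n → g (m * n) = g m + g n

/-- The law of `g p` when the prime `p ≤ n` is chosen with probability proportional to `1 / p`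
(the zero measure if `n < 2`, when there is no such prime). -/
noncomputable def primeLaw (g : ℕ → ℝ) (n : ℕ) : Measure ℝ :=
  (∑ p ∈ Nat.primesLE n, (p : ℝ≥0∞)⁻¹)⁻¹ •
    ∑ p ∈ Nat.primesLE n, (p : ℝ≥0∞)⁻¹ • Measure.dirac (g p)

/-- `g` is strongly additive, `ρ` has finite exponential moments of all orders, and the moment
generating functions of the measures `primeLaw g n` converge pointwise to that of `ρ`. -/
structure HasLimitLaw (g : ℕ → ℝ) (ρ : Measure ℝ) : Prop where
  stronglyAdditive : StronglyAdditive g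
  integrable_exp : ∀ θ : ℝ, Integrable (fun y => Real.exp (θ * y)) ρ
  tendsto_mgf : ∀ θ : ℝ,
    Tendsto (fun n => ∫ y, Real.exp (θ * y) ∂(primeLaw g n)) atTop
      (𝓝 (∫ y, Real.exp (θ * y) ∂ρ))

/-- `μ_n = ∑_{p ≤ n} g(p) / p`. -/
noncomputable def meanSum (g : ℕ → ℝ) (n : ℕ) : ℝ := ∑ p ∈ Nat.primesLE n, g p / p

/-- `σ_n ^ 2 = ∑_{p ≤ n} g(p) ^ 2 / p`. -/
noncomputable def varSum (g : ℕ → ℝ) (n : ℕ) : ℝ := ∑ p ∈ Nat.primesLE n, g p ^ 2 / p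

/-- The law of `(X(n) - μ_n) / a_n`, where `X(n) = g(V(n))` and `V(n)` is uniformly distributed on
`{1, …, n}`. -/
noncomputable def scaledLaw (g : ℕ → ℝ) (a : ℕ → ℝ) (n : ℕ) : Measure ℝ :=
  (uniformOn (Set.Icc 1 n)).map (fun m : ℕ => (g m - meanSum g n) / a n)

theorem isProbabilityMeasure_scaledLaw (g a : ℕ → ℝ) {n : ℕ} (hn : 1 ≤ n) :
    IsProbabilityMeasure (scaledLaw g a n) := by
  have := isProbabilityMeasure_uniformOn (s := Set.Icc 1 n) (Set.finite_Icc 1 n)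
    ⟨1, le_refl 1, hn⟩
  exact Measure.isProbabilityMeasure_map (Measurable.of_discrete).aemeasurable

end ErdosKac

namespace ErdosKac

/-! ### Estimates of Chebyshev and Mertens -/

/-! This is a moderate deviation principle, deduced from Gärtner–Ellis
(`satisfiesLDP_of_tendsto_cgf`). Put L = ∑_{p ≤ n} 1/p, τ = a_n / σ_n² and b = a_n² / σ_n² = τ²
σ_n², so that τ → 0 and b → ∞. The point is that the logarithm of the mean of exp(θ τ (g(m) - μ_n))
over m ≤ n is (θ²/2 + o(1)) b (`tendsto_centeredCgf`).

Were divisibility by distinct primes independent, the mean of exp(θ τ g(m)) would be ∏ (1 + (exp(θ τ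
g(p)) - 1)/p). Expanding its logarithm to second order gives θ τ μ_n + θ² b / 2. The errors are
o(b): convergence of exponential moments gives ∑ exp(8|g(p)|)/p = O(L), and ρ ≠ δ_0 gives σ_n² ≥ c
L.

Independence is accurate enough only for small primes, those with p^κ ≤ e where κ = 3L / log n;
there Rankin's trick (`abs_meanExp_sub_prod_le`) controls the error. By Mertens' estimates the
reciprocals of the large primes sum to at most log(3L) + O(1) = o(L), so by Cauchy–Schwarz these
primes carry a negligible share of the variance. For them an upper bound of the mean value up to a
constant factor suffices (`exists_meanExp_le`), because b → ∞.

Hölder's inequality, that is convexity of the logarithm of the mean, recombines the two parts. The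
upper bound splits θ τ g into small and large parts with weights 1 - ε and ε. The lower bound writes
a multiple of the small part as a convex combination of θ τ g and a negative multiple of the large
part, so again only an upper bound for the large part is needed. -/

theorem psi_le_six_mul {x : ℝ} (hx : 0 ≤ x) : Chebyshev.psi x ≤ 6 * x := by
  refine (Chebyshev.psi_le_const_mul_self hx).trans ?_
  have h : Real.log 4 ≤ 2 := by
    rw [show (4 : ℝ) = 2 ^ 2 by norm_num, Real.log_pow]
    have := Real.log_two_lt_d9
    push_cast
    linarith
  nlinarith

theorem sum_vonMangoldt_Ioc (n : ℕ) :
    ∑ d ∈ Finset.Ioc 0 n, ArithmeticFunction.vonMangoldt d = Chebyshev.psi n := by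
  simp [Chebyshev.psi]

/-- Compare with log n! = ∑ Λ(d) ⌊n/d⌋ ≤ n log n; removing the floors costs at most ψ(n) ≤ 6n. -/
theorem sum_vonMangoldt_div_le {n : ℕ} (hn : 1 ≤ n) :
    ∑ d ∈ Finset.Ioc 0 n, ArithmeticFunction.vonMangoldt d / d ≤ Real.log n + 6 := by
  have hn0 : (0 : ℝ) < n := by exact_mod_cast hn
  have h1 : ∑ d ∈ Finset.Ioc 0 n, ArithmeticFunction.vonMangoldt d * ((n / d : ℕ) : ℝ)
      ≤ n * Real.log n := by
    rw [← ArithmeticFunction.sum_Ioc_mul_zeta_eq_sum, ArithmeticFunction.vonMangoldt_mul_zeta]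
    calc ∑ m ∈ Finset.Ioc 0 n, ArithmeticFunction.log m
        ≤ ∑ m ∈ Finset.Ioc 0 n, Real.log n := by
          refine Finset.sum_le_sum fun m hm => ?_
          rw [Finset.mem_Ioc] at hm
          exact Real.log_le_log (by exact_mod_cast hm.1) (by exact_mod_cast hm.2)
      _ = n * Real.log n := by simp
  have h2 : ∑ d ∈ Finset.Ioc 0 n, ArithmeticFunction.vonMangoldt d / d * n
      ≤ ∑ d ∈ Finset.Ioc 0 n, (ArithmeticFunction.vonMangoldt d * ((n / d : ℕ) : ℝ)
        + ArithmeticFunction.vonMangoldt d) := by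
    refine Finset.sum_le_sum fun d hd => ?_
    have h : (n : ℝ) / d ≤ ((n / d : ℕ) : ℝ) + 1 := by
      rw [← Nat.floor_div_eq_div (K := ℝ)]
      exact (Nat.lt_floor_add_one _).le
    have := mul_le_mul_of_nonneg_left h (ArithmeticFunction.vonMangoldt_nonneg (n := d))
    calc _ = ArithmeticFunction.vonMangoldt d * ((n : ℝ) / d) := by ring
      _ ≤ _ := by linarith
  rw [Finset.sum_add_distrib, sum_vonMangoldt_Ioc, ← Finset.sum_mul] at h2
  have h3 := psi_le_six_mul hn0.le
  refine le_of_mul_le_mul_right ?_ hn0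
  linarith

/-- The sum of the reciprocals of the primes up to `n`. -/
noncomputable def primeHarmonic (n : ℕ) : ℝ := ∑ p ∈ Nat.primesLE n, (p : ℝ)⁻¹

theorem sum_log_div_primesLE_le {n : ℕ} (hn : 1 ≤ n) :
    ∑ p ∈ Nat.primesLE n, Real.log p / p ≤ Real.log n + 6 := by
  refine le_trans ?_ (sum_vonMangoldt_div_le hn)
  rw [Nat.primesLE_eq_filter_Ioc_zero, Finset.sum_filter]
  refine Finset.sum_le_sum fun p _ => ?_
  split_ifs with h
  · rw [ArithmeticFunction.vonMangoldt_apply_prime h]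
  · exact div_nonneg ArithmeticFunction.vonMangoldt_nonneg (Nat.cast_nonneg _)

theorem sum_primesLE_succ (f : ℕ → ℝ) (n : ℕ) :
    ∑ p ∈ Nat.primesLE (n + 1), f p
      = ∑ p ∈ Nat.primesLE n, f p + if (n + 1).Prime then f (n + 1) else 0 := by
  rw [Nat.primesLE_succ]
  split_ifs with h
  · rw [Finset.sum_insert (Nat.notMem_primesLE n), add_comm]
  · simp

/-- The upper half of Mertens' second theorem: partial summation from the bound on ∑ log p / p,
carried out as an induction on n. -/
theorem exists_primeHarmonic_le :
    ∃ C, ∀ n : ℕ, 2 ≤ n → primeHarmonic n ≤ Real.log (Real.log n) + C := by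
  obtain ⟨K, hK⟩ : ∃ K, primeHarmonic 2 - (∑ p ∈ Nat.primesLE 2, Real.log p / p) / Real.log 2
      = Real.log (Real.log 2) - 6 / Real.log 2 + K := ⟨_, (add_sub_cancel _ _).symm⟩
  have key : ∀ n : ℕ, 2 ≤ n →
      primeHarmonic n - (∑ p ∈ Nat.primesLE n, Real.log p / p) / Real.log n
        ≤ Real.log (Real.log n) - 6 / Real.log n + K := by
    intro n hn
    induction n, hn using Nat.le_induction with
    | base => exact_mod_cast hK.le
    | succ n hn ih =>
      have hn1 : (1 : ℝ) < n := by exact_mod_cast hn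
      have l0 : 0 < Real.log n := Real.log_pos hn1
      have l1 : Real.log n < Real.log ((n + 1 : ℕ) : ℝ) :=
        Real.log_lt_log (by linarith) (by push_cast; linarith)
      have l2 := l0.trans l1
      have hA := sum_log_div_primesLE_le (n := n) (by omega)
      set A := ∑ p ∈ Nat.primesLE n, Real.log p / p
      set u := Real.log (n : ℝ)
      set v := Real.log ((n + 1 : ℕ) : ℝ)
      -- If n + 1 is prime, it adds 1/(n + 1) to both terms of the difference, so only the change of
      -- denominator from log n to log (n + 1) matters.
      have e : primeHarmonic (n + 1) - (∑ p ∈ Nat.primesLE (n + 1), Real.log p / p) / v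
          = primeHarmonic n - A / v := by
        unfold primeHarmonic
        rw [sum_primesLE_succ, sum_primesLE_succ]
        split_ifs
        · have : v ≠ 0 := l2.ne'
          have h' : ((n + 1 : ℕ) : ℝ) ≠ 0 := by positivity
          change _ + _ - (A + v / _) / v = _
          field_simp
          ring
        · simp [A]
      rw [e]
      have h1 : A * (u⁻¹ - v⁻¹) ≤ (u + 6) * (u⁻¹ - v⁻¹) :=
        mul_le_mul_of_nonneg_right hA (sub_nonneg.2 (inv_anti₀ l0 l1.le))
      have h2 : (u + 6) * (u⁻¹ - v⁻¹) = 1 - u / v + 6 / u - 6 / v := by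
        field_simp
        ring
      have h3 : 1 - u / v ≤ Real.log v - Real.log u := by
        have := Real.one_sub_inv_le_log_of_pos (div_pos l2 l0)
        rwa [inv_div, Real.log_div l2.ne' l0.ne'] at this
      have h4 : A * (u⁻¹ - v⁻¹) = A / u - A / v := by ring
      linarith
  have l2 : 0 < Real.log 2 := Real.log_pos one_lt_two
  refine ⟨1 + K, fun n hn => ?_⟩
  have hn1 : (2 : ℝ) ≤ n := by exact_mod_cast hn
  have l0 : 0 < Real.log n := Real.log_pos (by linarith)
  have hA := sum_log_div_primesLE_le (n := n) (by omega)
  have h1 : (∑ p ∈ Nat.primesLE n, Real.log p / p) / Real.log n ≤ 1 + 6 / Real.log n := by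
    rw [div_le_iff₀ l0]
    field_simp
    linarith
  have := key n hn
  linarith

/-! ### Sums over the prime factors -/

/-- `∑_{p ∣ m} w(p)`. -/
noncomputable def primeSum (w : ℕ → ℝ) (m : ℕ) : ℝ := ∑ p ∈ m.primeFactors, w p

theorem primeSum_mul_of_coprime (w : ℕ → ℝ) {m k : ℕ} (h : m.Coprime k) :
    primeSum w (m * k) = primeSum w m + primeSum w k := by
  rw [primeSum, h.primeFactors_mul, Finset.sum_union h.disjoint_primeFactors]
  rfl

theorem primeSum_add (v w : ℕ → ℝ) (m : ℕ) :
    primeSum (fun p => v p + w p) m = primeSum v m + primeSum w m :=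
  Finset.sum_add_distrib

theorem primeSum_const_mul (c : ℝ) (w : ℕ → ℝ) (m : ℕ) :
    primeSum (fun p => c * w p) m = c * primeSum w m :=
  (Finset.mul_sum _ _ _).symm

theorem StronglyAdditive.eq_primeSum {g : ℕ → ℝ} (hg : StronglyAdditive g) {m : ℕ} (hm : m ≠ 0) :
    g m = primeSum g m := by
  induction m using Nat.recOnPosPrimePosCoprime with
  | zero => exact absurd rfl hm
  | one =>
    have := hg.mul 1 1 (by simp)
    simp only [mul_one, left_eq_add] at this
    simp [primeSum, this]
  | prime_pow p k hp hk =>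
    rw [hg.prime_pow p k hp hk, primeSum, Nat.primeFactors_prime_pow hk.ne' hp,
      Finset.sum_singleton]
  | coprime a b ha hb hab iha ihb =>
    rw [hg.mul a b hab, primeSum_mul_of_coprime _ hab, iha (by omega), ihb (by omega)]

/-- The mean value of `m ↦ exp (∑_{p ∣ m} w(p))` over `{1, …, n}`. -/
noncomputable def meanExp (w : ℕ → ℝ) (n : ℕ) : ℝ :=
  (∑ m ∈ Finset.Ioc 0 n, Real.exp (primeSum w m)) / n

theorem primeFactors_eq_filter {m n : ℕ} (hm : m ∈ Finset.Ioc 0 n) :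
    m.primeFactors = (Nat.primesLE n).filter (· ∣ m) := by
  rw [Finset.mem_Ioc] at hm
  ext p
  simp only [Nat.mem_primeFactors, Finset.mem_filter, Nat.mem_primesLE]
  constructor
  · rintro ⟨h1, h2, h3⟩
    exact ⟨⟨(Nat.le_of_dvd hm.1 h2).trans hm.2, h1⟩, h2⟩
  · rintro ⟨⟨_, h1⟩, h2⟩
    exact ⟨h1, h2, hm.1.ne'⟩

/-- Expanding ∏_{p ∣ m} (1 + (exp(w(p)) - 1)) over sets D of primes turns the sum into counts of
multiples of ∏ D. -/
theorem sum_exp_primeSum (w : ℕ → ℝ) (n : ℕ) :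
    ∑ m ∈ Finset.Ioc 0 n, Real.exp (primeSum w m)
      = ∑ D ∈ (Nat.primesLE n).powerset,
          (∏ p ∈ D, (Real.exp (w p) - 1)) * ((n / ∏ p ∈ D, p : ℕ) : ℝ) := by
  have h : ∀ m ∈ Finset.Ioc 0 n, Real.exp (primeSum w m)
      = ∑ D ∈ (Nat.primesLE n).powerset,
        if (∏ p ∈ D, p) ∣ m then ∏ p ∈ D, (Real.exp (w p) - 1) else 0 := by
    intro m hm
    rw [primeSum, primeFactors_eq_filter hm, Real.exp_sum, Finset.prod_filter]
    calc _ = ∏ p ∈ Nat.primesLE n, (1 + if p ∣ m then Real.exp (w p) - 1 else 0) := by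
          refine Finset.prod_congr rfl fun p _ => ?_
          split_ifs <;> ring
      _ = _ := by
          rw [Finset.prod_one_add]
          refine Finset.sum_congr rfl fun D hD => ?_
          rw [Finset.mem_powerset] at hD
          split_ifs with hd
          · refine Finset.prod_congr rfl fun p hp => if_pos ((Finset.dvd_prod_of_mem _ hp).trans hd)
          · have : ∃ p ∈ D, ¬ p ∣ m := by
              by_contra! hcon
              exact hd (Finset.prod_primes_dvd _
                (fun p hp => (Nat.prime_of_mem_primesLE (hD hp)).prime) hcon)
            obtain ⟨p, hp, hpm⟩ := this
            exact Finset.prod_eq_zero hp (if_neg hpm)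
  rw [Finset.sum_congr rfl h, Finset.sum_comm]
  refine Finset.sum_congr rfl fun D _ => ?_
  rw [← Finset.sum_filter, Finset.sum_const, Nat.Ioc_filter_dvd_card_eq_div, nsmul_eq_mul, mul_comm]

theorem prod_pos_of_mem_powerset {n : ℕ} {D : Finset ℕ} (hD : D ∈ (Nat.primesLE n).powerset) :
    0 < ∏ p ∈ D, p :=
  Finset.prod_pos fun _ hp => (Nat.prime_of_mem_primesLE (Finset.mem_powerset.1 hD hp)).pos

/-- All coefficients exp(w(p)) - 1 are nonnegative, so each floor ⌊n/d⌋ may be replaced by n/d. -/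
theorem meanExp_le_of_nonneg {w : ℕ → ℝ} (hw : ∀ p, 0 ≤ w p) {n : ℕ} (hn : 1 ≤ n) :
    meanExp w n ≤ Real.exp (∑ p ∈ Nat.primesLE n, (Real.exp (w p) - 1) / p) := by
  have hn0 : (0 : ℝ) < n := by exact_mod_cast hn
  have h0 : ∀ p, 0 ≤ Real.exp (w p) - 1 := fun p => by
    have := Real.one_le_exp (hw p)
    linarith
  refine le_trans ?_ (Real.prod_one_add_le_exp_sum _ fun p => div_nonneg (h0 p) (Nat.cast_nonneg p))
  rw [meanExp, sum_exp_primeSum, Finset.prod_one_add, Finset.sum_div]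
  refine Finset.sum_le_sum fun D hD => ?_
  rw [Finset.prod_div_distrib, mul_div_assoc, div_eq_mul_inv (∏ p ∈ D, (Real.exp (w p) - 1))]
  refine mul_le_mul_of_nonneg_left ?_ (Finset.prod_nonneg fun p _ => h0 p)
  rw [div_le_iff₀ hn0, ← Nat.cast_prod]
  refine Nat.cast_div_le.trans_eq ?_
  ring

/-- The rounding error is at most min(1/n, 1/d), and this minimum is at most (d/n)^κ / d for κ in
[0, 1]. -/
theorem abs_cast_div_div_sub_inv_le {n d : ℕ} (hn : 1 ≤ n) (hd : 0 < d) {κ : ℝ} (h0 : 0 ≤ κ)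
    (h1 : κ ≤ 1) : |((n / d : ℕ) : ℝ) / n - (d : ℝ)⁻¹| ≤ (n : ℝ) ^ (-κ) * ((d : ℝ) ^ κ / d) := by
  have hn0 : (0 : ℝ) < n := by exact_mod_cast hn
  have hd0 : (0 : ℝ) < d := by exact_mod_cast hd
  have e : (n : ℝ) ^ (-κ) * ((d : ℝ) ^ κ / d) = ((d : ℝ) / n) ^ κ / d := by
    rw [Real.div_rpow hd0.le hn0.le, Real.rpow_neg hn0.le]
    field_simp
  rw [e]
  have hle : ((n / d : ℕ) : ℝ) ≤ n / d := Nat.cast_div_le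
  have hlt : (n : ℝ) / d < ((n / d : ℕ) : ℝ) + 1 := by
    rw [← Nat.floor_div_eq_div (K := ℝ)]
    exact Nat.lt_floor_add_one _
  have e2 : ((n / d : ℕ) : ℝ) / n - (d : ℝ)⁻¹ = (((n / d : ℕ) : ℝ) - n / d) / n := by
    field_simp
  rw [e2, abs_div, abs_of_nonpos (by linarith), abs_of_pos hn0]
  rcases le_total (d : ℝ) n with h | h
  · have hx : (d : ℝ) / n ≤ ((d : ℝ) / n) ^ κ := by
      conv_lhs => rw [← Real.rpow_one ((d : ℝ) / n)]
      exact Real.rpow_le_rpow_of_exponent_ge (by positivity) ((div_le_one hn0).2 h) h1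
    calc _ ≤ 1 / (n : ℝ) := by gcongr; linarith
      _ = (d : ℝ) / n / d := by field_simp
      _ ≤ _ := by gcongr
  · have hx : 1 ≤ ((d : ℝ) / n) ^ κ := Real.one_le_rpow ((one_le_div hn0).2 h) h0
    calc _ ≤ ((n : ℝ) / d) / n := by
          gcongr
          have : (0 : ℝ) ≤ ((n / d : ℕ) : ℝ) := Nat.cast_nonneg _
          linarith
      _ = 1 / (d : ℝ) := by field_simp
      _ ≤ _ := by gcongr

/-- Rankin's trick: the mean value is close to that of the independent model. -/
theorem abs_meanExp_sub_prod_le (w : ℕ → ℝ) {n : ℕ} (hn : 1 ≤ n) {κ : ℝ} (h0 : 0 ≤ κ)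
    (h1 : κ ≤ 1) :
    |meanExp w n - ∏ p ∈ Nat.primesLE n, (1 + (Real.exp (w p) - 1) / p)|
      ≤ (n : ℝ) ^ (-κ)
        * Real.exp (∑ p ∈ Nat.primesLE n, |Real.exp (w p) - 1| * (p : ℝ) ^ κ / p) := by
  have hn0 : (0 : ℝ) < n := by exact_mod_cast hn
  refine le_trans ?_ (mul_le_mul_of_nonneg_left
    (Real.prod_one_add_le_exp_sum _ fun p => by positivity) (by positivity))
  rw [meanExp, sum_exp_primeSum, Finset.prod_one_add, Finset.prod_one_add, Finset.sum_div,
    ← Finset.sum_sub_distrib, Finset.mul_sum]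
  refine (Finset.abs_sum_le_sum_abs _ _).trans (Finset.sum_le_sum fun D hD => ?_)
  have hd := prod_pos_of_mem_powerset hD
  have := abs_cast_div_div_sub_inv_le hn hd h0 h1
  set d := ∏ p ∈ D, p with hddef
  have e1 : ∏ p ∈ D, (Real.exp (w p) - 1) / (p : ℝ)
      = (∏ p ∈ D, (Real.exp (w p) - 1)) * (d : ℝ)⁻¹ := by
    rw [Finset.prod_div_distrib, hddef, Nat.cast_prod, div_eq_mul_inv]
  have e2 : ∏ p ∈ D, |Real.exp (w p) - 1| * (p : ℝ) ^ κ / p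
      = |∏ p ∈ D, (Real.exp (w p) - 1)| * ((d : ℝ) ^ κ / d) := by
    rw [Finset.prod_div_distrib, Finset.prod_mul_distrib, ← Finset.abs_prod,
      Real.finsetProd_rpow _ _ (fun p _ => Nat.cast_nonneg p), hddef, Nat.cast_prod, mul_div_assoc]
  rw [e1, e2, mul_div_assoc, ← mul_sub, abs_mul, mul_left_comm]
  exact mul_le_mul_of_nonneg_left this (abs_nonneg _)

/-! ### An upper bound for mean values of multiplicative functions bounded by one -/

theorem primeSum_mul_le {w : ℕ → ℝ} (hw : ∀ p, w p ≤ 0) {j d : ℕ} (hj : j ≠ 0) (hd : d ≠ 0) :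
    primeSum w (j * d) ≤ primeSum w j := by
  rw [primeSum, primeSum, Nat.primeFactors_mul hj hd]
  have := Finset.sum_le_sum_of_subset_of_nonneg
    (Finset.subset_union_left (s₁ := j.primeFactors) (s₂ := d.primeFactors)) (f := fun p => -w p)
    fun p _ _ => neg_nonneg.2 (hw p)
  simpa using this

/-- The arithmetic function `m ↦ exp (∑_{p ∣ m} w(p))`. -/
noncomputable def expPrimeSum (w : ℕ → ℝ) : ArithmeticFunction ℝ :=
  ⟨fun m => if m = 0 then 0 else Real.exp (primeSum w m), if_pos rfl⟩

theorem expPrimeSum_apply (w : ℕ → ℝ) {m : ℕ} (hm : m ≠ 0) :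
    expPrimeSum w m = Real.exp (primeSum w m) := if_neg hm

/-- Write log m = ∑_{d ∣ m} Λ(d). As w ≤ 0, passing from m = jd to its divisor j can only increase
the exponential, so the sum over d is at most ψ(n/j). -/
theorem sum_exp_primeSum_mul_log_le {w : ℕ → ℝ} (hw : ∀ p, w p ≤ 0) (n : ℕ) :
    ∑ m ∈ Finset.Ioc 0 n, Real.exp (primeSum w m) * Real.log m
      ≤ ∑ j ∈ Finset.Ioc 0 n, Real.exp (primeSum w j) * (6 * (n / j)) := by
  calc _ ≤ ∑ m ∈ Finset.Ioc 0 n, (expPrimeSum w * ArithmeticFunction.vonMangoldt) m := by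
        refine Finset.sum_le_sum fun m hm => ?_
        rw [Finset.mem_Ioc] at hm
        rw [ArithmeticFunction.mul_apply, ← ArithmeticFunction.vonMangoldt_sum,
          Nat.sum_divisorsAntidiagonal' (fun j d =>
            expPrimeSum w j * ArithmeticFunction.vonMangoldt d), Finset.mul_sum]
        refine Finset.sum_le_sum fun d hd => ?_
        have hdm := Nat.dvd_of_mem_divisors hd
        have hd0 : d ≠ 0 := (Nat.pos_of_mem_divisors hd).ne'
        have hj0 : m / d ≠ 0 := (Nat.div_pos (Nat.le_of_dvd hm.1 hdm) (Nat.pos_of_ne_zero hd0)).ne'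
        refine mul_le_mul_of_nonneg_right ?_ ArithmeticFunction.vonMangoldt_nonneg
        rw [expPrimeSum_apply _ hj0]
        have := primeSum_mul_le hw hj0 hd0
        rw [Nat.div_mul_cancel hdm] at this
        exact Real.exp_le_exp.2 this
    _ = ∑ j ∈ Finset.Ioc 0 n, Real.exp (primeSum w j) * Chebyshev.psi ((n / j : ℕ) : ℝ) := by
        rw [ArithmeticFunction.sum_Ioc_mul_eq_sum_sum]
        refine Finset.sum_congr rfl fun j hj => ?_
        rw [Finset.mem_Ioc] at hj
        rw [sum_vonMangoldt_Ioc, expPrimeSum_apply _ hj.1.ne']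
    _ ≤ _ := by
        refine Finset.sum_le_sum fun j _ => mul_le_mul_of_nonneg_left ?_ (Real.exp_nonneg _)
        refine (psi_le_six_mul (Nat.cast_nonneg _)).trans ?_
        have : ((n / j : ℕ) : ℝ) ≤ n / j := Nat.cast_div_le
        linarith

/-- Split log n = log m + log(n/m) and use log(n/m) ≤ n/m; the constant is 7 = 6 + 1. -/
theorem log_mul_sum_exp_primeSum_le {w : ℕ → ℝ} (hw : ∀ p, w p ≤ 0) {n : ℕ} (hn : 1 ≤ n) :
    Real.log n * ∑ m ∈ Finset.Ioc 0 n, Real.exp (primeSum w m)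
      ≤ 7 * n * ∑ j ∈ Finset.Ioc 0 n, Real.exp (primeSum w j) / j := by
  have hn0 : (0 : ℝ) < n := by exact_mod_cast hn
  have h1 := sum_exp_primeSum_mul_log_le hw n
  have h2 : ∑ m ∈ Finset.Ioc 0 n, Real.exp (primeSum w m) * Real.log (n / m)
      ≤ ∑ m ∈ Finset.Ioc 0 n, Real.exp (primeSum w m) * (n / m) := by
    refine Finset.sum_le_sum fun m _ => mul_le_mul_of_nonneg_left ?_ (Real.exp_nonneg _)
    exact Real.log_le_self (by positivity)
  have h3 : Real.log n * ∑ m ∈ Finset.Ioc 0 n, Real.exp (primeSum w m)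
      = ∑ m ∈ Finset.Ioc 0 n, Real.exp (primeSum w m) * Real.log m
        + ∑ m ∈ Finset.Ioc 0 n, Real.exp (primeSum w m) * Real.log (n / m) := by
    rw [← Finset.sum_add_distrib, Finset.mul_sum]
    refine Finset.sum_congr rfl fun m hm => ?_
    rw [Finset.mem_Ioc] at hm
    have : (m : ℝ) ≠ 0 := by exact_mod_cast hm.1.ne'
    rw [Real.log_div hn0.ne' this]
    ring
  rw [h3]
  refine (add_le_add h1 h2).trans_eq ?_
  rw [← Finset.sum_add_distrib, Finset.mul_sum]
  exact Finset.sum_congr rfl fun m _ => by ring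

theorem hasSum_exp_primeSum_prime_pow {w : ℕ → ℝ} {p : ℕ} (hp : p.Prime) :
    HasSum (fun k : ℕ => Real.exp (primeSum w (p ^ k)) / ((p ^ k : ℕ) : ℝ))
      (1 + Real.exp (w p) / (p - 1)) := by
  have hp1 : (1 : ℝ) < p := by exact_mod_cast hp.one_lt
  have h := (hasSum_geometric_of_lt_one (r := (p : ℝ)⁻¹) (by positivity)
    (inv_lt_one_of_one_lt₀ hp1)).mul_left (Real.exp (w p) * (p : ℝ)⁻¹)
  rw [← hasSum_nat_add_iff' 1]
  have e : 1 + Real.exp (w p) / ((p : ℝ) - 1)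
      - ∑ i ∈ Finset.range 1, Real.exp (primeSum w (p ^ i)) / ((p ^ i : ℕ) : ℝ)
      = Real.exp (w p) * (p : ℝ)⁻¹ * (1 - (p : ℝ)⁻¹)⁻¹ := by
    have h1 : (p : ℝ) - 1 ≠ 0 := by linarith
    have h2 : (1 : ℝ) - (p : ℝ)⁻¹ ≠ 0 := by
      have := inv_lt_one_of_one_lt₀ hp1
      linarith
    simp only [Finset.range_one, Finset.sum_singleton, pow_zero, primeSum, Nat.primeFactors_one,
      Finset.sum_empty, Real.exp_zero, Nat.cast_one, div_one]
    field_simp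
    ring
  rw [e]
  refine h.congr_fun fun k => ?_
  rw [primeSum, Nat.primeFactors_prime_pow (Nat.succ_ne_zero k) hp, Finset.sum_singleton]
  push_cast
  rw [pow_succ, inv_pow]
  field_simp

/-- Every j ≤ n has only prime factors at most n, so the sum is part of the Euler product over these
primes. -/
theorem sum_exp_primeSum_div_le (w : ℕ → ℝ) (n : ℕ) :
    ∑ j ∈ Finset.Ioc 0 n, Real.exp (primeSum w j) / j
      ≤ ∏ p ∈ Nat.primesLE n, (1 + Real.exp (w p) / (p - 1)) := by
  set f : ℕ → ℝ := fun m => expPrimeSum w m / m with hf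
  have hpow : ∀ {p : ℕ}, p.Prime → HasSum (fun k : ℕ => f (p ^ k))
      (1 + Real.exp (w p) / (p - 1)) := by
    intro p hp
    have := hasSum_exp_primeSum_prime_pow (w := w) hp
    refine this.congr_fun fun k => ?_
    rw [hf]
    simp only
    rw [expPrimeSum_apply _ (pow_ne_zero k hp.ne_zero)]
  have hnn : ∀ m, 0 ≤ f m := by
    intro m
    refine div_nonneg ?_ (Nat.cast_nonneg m)
    rcases eq_or_ne m 0 with rfl | h
    · simp
    · rw [expPrimeSum_apply _ h]
      positivity
  have h := (EulerProduct.summable_and_hasSum_smoothNumbers_prod_primesBelow_tsum (f := f)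
    (by simp [hf, expPrimeSum_apply, primeSum]) (by
      intro m k hmk
      rcases eq_or_ne m 0 with rfl | h1
      · simp [hf]
      rcases eq_or_ne k 0 with rfl | h2
      · simp [hf]
      simp only [hf]
      rw [expPrimeSum_apply _ h1, expPrimeSum_apply _ h2, expPrimeSum_apply _ (mul_ne_zero h1 h2),
        primeSum_mul_of_coprime _ hmk, Real.exp_add]
      push_cast
      field_simp) (by
      intro p hp
      simpa only [Real.norm_of_nonneg (hnn _)] using (hpow hp).summable) (n + 1)).2
  have hsub : ∀ j ∈ Finset.Ioc 0 n, j ∈ (n + 1).smoothNumbers := by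
    intro j hj
    rw [Finset.mem_Ioc] at hj
    exact Nat.mem_smoothNumbers_of_lt hj.1 (by omega)
  calc ∑ j ∈ Finset.Ioc 0 n, Real.exp (primeSum w j) / j
      = ∑ j ∈ (Finset.Ioc 0 n).subtype (· ∈ (n + 1).smoothNumbers), f j := by
        rw [Finset.sum_subtype_of_mem f hsub]
        refine Finset.sum_congr rfl fun j hj => ?_
        rw [Finset.mem_Ioc] at hj
        simp only [hf]
        rw [expPrimeSum_apply _ hj.1.ne']
    _ ≤ ∏ p ∈ (n + 1).primesBelow, ∑' k : ℕ, f (p ^ k) :=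
        sum_le_hasSum _ (fun j _ => hnn j) h
    _ = _ := by
        refine Finset.prod_congr rfl fun p hp => ?_
        exact (hpow (Nat.prime_of_mem_primesBelow hp)).tsum_eq

/-- A telescoping sum over all integers; it bounds the cost of replacing p - 1 by p in Euler
factors. -/
theorem sum_inv_mul_pred_le (n : ℕ) :
    ∑ p ∈ Nat.primesLE n, ((p : ℝ) * (p - 1))⁻¹ ≤ 1 := by
  have h : ∑ p ∈ Nat.primesLE n, ((p : ℝ) * (p - 1))⁻¹
      ≤ ∑ k ∈ Finset.Ioc 1 n, ((k : ℝ) * (k - 1))⁻¹ := by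
    rw [Nat.primesLE_eq_filter_Ioc_one]
    refine Finset.sum_le_sum_of_subset_of_nonneg (Finset.filter_subset _ _) fun k hk _ => ?_
    rw [Finset.mem_Ioc] at hk
    have : (1 : ℝ) < k := by exact_mod_cast hk.1
    exact inv_nonneg.2 (mul_nonneg (by linarith) (by linarith))
  have h2 : ∀ n : ℕ, 1 ≤ n → ∑ k ∈ Finset.Ioc 1 n, ((k : ℝ) * (k - 1))⁻¹ = 1 - (n : ℝ)⁻¹ := by
    intro n hn
    induction n, hn using Nat.le_induction with
    | base => simp
    | succ n hn ih =>
      rw [Finset.sum_Ioc_succ_top (by omega), ih]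
      have : (n : ℝ) ≠ 0 := by exact_mod_cast (show n ≠ 0 by omega)
      push_cast
      rw [add_sub_cancel_right]
      field_simp
      ring
  refine h.trans ?_
  rcases Nat.eq_zero_or_pos n with rfl | hn
  · simp
  · rw [h2 n hn]
    have : (0 : ℝ) ≤ (n : ℝ)⁻¹ := by positivity
    linarith

theorem sum_exp_primeSum_div_le_exp {w : ℕ → ℝ} (hw : ∀ p, w p ≤ 0) (n : ℕ) :
    ∑ j ∈ Finset.Ioc 0 n, Real.exp (primeSum w j) / j
      ≤ Real.exp (∑ p ∈ Nat.primesLE n, Real.exp (w p) / p + 1) := by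
  refine (sum_exp_primeSum_div_le w n).trans ?_
  calc _ ≤ Real.exp (∑ p ∈ Nat.primesLE n, Real.exp (w p) / (p - 1)) := by
        rw [Real.exp_sum]
        refine Finset.prod_le_prod (fun p hp => ?_) fun p hp => ?_
        · have : (1 : ℝ) < p := by exact_mod_cast Nat.one_lt_of_mem_primesLE hp
          have : 0 ≤ Real.exp (w p) / (p - 1) := div_nonneg (Real.exp_nonneg _) (by linarith)
          linarith
        · rw [add_comm]
          exact Real.add_one_le_exp _
    _ ≤ _ := by
        refine Real.exp_le_exp.2 (le_trans ?_
          (add_le_add_right (sum_inv_mul_pred_le n) _))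
        rw [← Finset.sum_add_distrib]
        refine Finset.sum_le_sum fun p hp => ?_
        have h1 : (1 : ℝ) < p := by exact_mod_cast Nat.one_lt_of_mem_primesLE hp
        have h2 : (0 : ℝ) < (p : ℝ) - 1 := by linarith
        have h3 : Real.exp (w p) ≤ 1 := Real.exp_le_one_iff.2 (hw p)
        have h4 : Real.exp (w p) / (p - 1)
            = Real.exp (w p) / p + Real.exp (w p) * ((p : ℝ) * (p - 1))⁻¹ := by
          field_simp
          ring
        rw [h4]
        have : 0 ≤ ((p : ℝ) * (p - 1))⁻¹ := by positivity
        nlinarith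

/-- The Euler product bound with w = 0 dominates the harmonic sum. This is the lower half of
Mertens' estimate. -/
theorem log_succ_le_exp_primeHarmonic (n : ℕ) :
    Real.log (n + 1 : ℕ) ≤ Real.exp (primeHarmonic n + 1) := by
  have h := sum_exp_primeSum_div_le_exp (w := fun _ => 0) (fun _ => le_rfl) n
  have h1 := log_add_one_le_harmonic n
  simp only [primeSum, Finset.sum_const_zero, Real.exp_zero, one_div] at h
  refine h1.trans (le_trans (le_of_eq ?_) h)
  rw [harmonic_eq_sum_Icc]
  push_cast
  rfl

/-- The factor 1/log n gained above is at most exp(C - ∑ 1/p) by Mertens, which turns exp(w(p))/p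
into (exp(w(p)) - 1)/p. -/
theorem exists_meanExp_le_of_nonpos :
    ∃ C, ∀ w : ℕ → ℝ, (∀ p, w p ≤ 0) → ∀ n : ℕ, 2 ≤ n →
      meanExp w n ≤ Real.exp (∑ p ∈ Nat.primesLE n, (Real.exp (w p) - 1) / p + C) := by
  obtain ⟨C, hC⟩ := exists_primeHarmonic_le
  refine ⟨Real.log 7 + 1 + C, fun w hw n hn => ?_⟩
  have hn1 : (2 : ℝ) ≤ n := by exact_mod_cast hn
  have hn0 : (0 : ℝ) < n := by linarith
  have l0 : 0 < Real.log n := Real.log_pos (by linarith)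
  have h1 := log_mul_sum_exp_primeSum_le hw (n := n) (by omega)
  have h2 := sum_exp_primeSum_div_le_exp hw n
  have h3 : Real.exp (primeHarmonic n - C) ≤ Real.log n := by
    rw [← Real.exp_log l0]
    exact Real.exp_le_exp.2 (by linarith [hC n hn, Real.exp_log l0])
  have e : ∑ p ∈ Nat.primesLE n, (Real.exp (w p) - 1) / p
      = ∑ p ∈ Nat.primesLE n, Real.exp (w p) / p - primeHarmonic n := by
    rw [primeHarmonic, ← Finset.sum_sub_distrib]
    exact Finset.sum_congr rfl fun p _ => by rw [sub_div, one_div]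
  have h4 : 0 ≤ ∑ m ∈ Finset.Ioc 0 n, Real.exp (primeSum w m) :=
    Finset.sum_nonneg fun _ _ => Real.exp_nonneg _
  rw [meanExp, div_le_iff₀ hn0]
  refine le_of_mul_le_mul_left ?_ (Real.exp_pos (primeHarmonic n - C))
  calc _ ≤ Real.log n * ∑ m ∈ Finset.Ioc 0 n, Real.exp (primeSum w m) := by gcongr
    _ ≤ _ := h1
    _ ≤ 7 * n * Real.exp (∑ p ∈ Nat.primesLE n, Real.exp (w p) / p + 1) := by gcongr
    _ = _ := by
      rw [← mul_assoc, ← Real.exp_add, e]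
      rw [show primeHarmonic n - C + (∑ p ∈ Nat.primesLE n, Real.exp (w p) / p - primeHarmonic n
        + (Real.log 7 + 1 + C)) = Real.log 7 + (∑ p ∈ Nat.primesLE n, Real.exp (w p) / p + 1) by
        ring, Real.exp_add (Real.log 7), Real.exp_log (by norm_num)]
      ring

/-- An upper bound for the mean value of a strongly multiplicative function. -/
theorem exists_meanExp_le :
    ∃ C, ∀ w : ℕ → ℝ, ∀ n : ℕ, 2 ≤ n →
      meanExp w n ≤ Real.exp ((∑ p ∈ Nat.primesLE n, (Real.exp (2 * w p) - 1) / p + C) / 2) := by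
  obtain ⟨C, hC⟩ := exists_meanExp_le_of_nonpos
  refine ⟨C, fun w n hn => ?_⟩
  have hn0 : (0 : ℝ) < n := by exact_mod_cast (by omega)
  have h1 := meanExp_le_of_nonneg (w := fun p => 2 * max (w p) 0) (fun p => by positivity)
    (n := n) (by omega)
  have h2 := hC (fun p => 2 * min (w p) 0)
    (fun p => by linarith [min_le_right (w p) 0]) n hn
  set P := meanExp (fun p => 2 * max (w p) 0) n
  set N := meanExp (fun p => 2 * min (w p) 0) n
  have hP : 0 ≤ P := by unfold P meanExp; positivity
  -- Cauchy–Schwarz for w = max(w, 0) + min(w, 0) separates the signs, at the price of doubling the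
  -- exponents.
  have hCS : meanExp w n ^ 2 ≤ P * N := by
    have := Finset.sum_mul_sq_le_sq_mul_sq (Finset.Ioc 0 n)
      (fun m => Real.exp (primeSum (fun p => max (w p) 0) m))
      (fun m => Real.exp (primeSum (fun p => min (w p) 0) m))
    unfold P N meanExp
    simp only [← Real.exp_add, ← primeSum_add, max_add_min, add_zero, ← Real.exp_nat_mul,
      primeSum_const_mul] at this ⊢
    rw [div_pow, div_mul_div_comm, ← sq]
    gcongr
    simpa using this
  have h3 : P * N ≤ Real.exp (∑ p ∈ Nat.primesLE n, (Real.exp (2 * w p) - 1) / p + C) := by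
    refine (mul_le_mul h1 h2 (by unfold N meanExp; positivity) (Real.exp_nonneg _)).trans_eq ?_
    rw [← Real.exp_add, ← add_assoc, ← Finset.sum_add_distrib]
    congr 2
    refine Finset.sum_congr rfl fun p _ => ?_
    -- At each prime one of the two parts vanishes, so the two exponents add up to that of 2w.
    rcases le_total (w p) 0 with h | h <;> simp [h]
  refine (Real.le_sqrt_of_sq_le (hCS.trans h3)).trans_eq ?_
  rw [Real.exp_half]

/-! ### The Gärtner–Ellis theorem for a quadratic limit -/

theorem log_div_le_of_toReal_le {p : ℝ≥0∞} (hp : p ≠ ∞) {b c : ℝ} (hb : 0 < b)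
    (h : p.toReal ≤ Real.exp (b * c)) : ENNReal.log p / (b : EReal) ≤ (c : EReal) := by
  rw [EReal.div_le_iff_le_mul (by exact_mod_cast hb) (EReal.coe_ne_top b), ← EReal.coe_mul]
  have h1 : p ≤ ENNReal.ofReal (Real.exp (b * c)) := (ENNReal.le_ofReal_iff_toReal_le hp
    (Real.exp_nonneg _)).2 h
  refine (ENNReal.log_monotone h1).trans_eq ?_
  rw [ENNReal.log_ofReal_of_pos (Real.exp_pos _), Real.log_exp]

theorem le_log_div_of_le_toReal {p : ℝ≥0∞} {b c : ℝ} (hb : 0 < b)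
    (h : Real.exp (b * c) ≤ p.toReal) : (c : EReal) ≤ ENNReal.log p / (b : EReal) := by
  rw [EReal.le_div_iff_mul_le (by exact_mod_cast hb) (EReal.coe_ne_top b), ← EReal.coe_mul]
  have h1 : ENNReal.ofReal (Real.exp (b * c)) ≤ p := ENNReal.ofReal_le_of_le_toReal h
  refine le_trans (le_of_eq ?_) (ENNReal.log_monotone h1)
  rw [ENNReal.log_ofReal_of_pos (Real.exp_pos _), Real.log_exp, mul_comm]

/-- Chernoff's bound on both half-lines, at the parameters ± r b that are optimal for the rate x²/2.
-/
theorem measureReal_le_of_forall_le_abs {μ : Measure ℝ} [IsProbabilityMeasure μ]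
    (hint : ∀ θ : ℝ, Integrable (fun x => Real.exp (θ * x)) μ) {A : Set ℝ} {r b : ℝ} (hr : 0 ≤ r)
    (hb : 0 ≤ b) (hA : ∀ x ∈ A, r ≤ |x|) :
    μ.real A ≤ Real.exp (-(r * b) * r + cgf id μ (r * b))
      + Real.exp (-(r * b) * r + cgf id μ (-r * b)) := by
  have h1 := measure_ge_le_exp_cgf (μ := μ) (X := id) r (mul_nonneg hr hb) (hint _)
  have h2 := measure_le_le_exp_cgf (μ := μ) (X := id) (-r)
    (by nlinarith : -r * b ≤ 0) (hint _)
  have h3 : μ.real A ≤ μ.real ({x | r ≤ id x} ∪ {x | id x ≤ -r}) := by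
    refine measureReal_mono fun x hx => ?_
    rcases le_abs'.1 (hA x hx) with h | h
    · exact Or.inr h
    · exact Or.inl h
  refine h3.trans ((measureReal_union_le _ _).trans (add_le_add h1 (h2.trans_eq ?_)))
  ring_nf

/-- Replaces the change of measure in the Gärtner–Ellis lower bound. Inside the ball the integrand
is bounded by a constant; outside, moving the tilt from x to x ± δ only increases it. -/
theorem mgf_le_measureReal_ball_add {μ : Measure ℝ} [IsProbabilityMeasure μ]
    (hint : ∀ θ : ℝ, Integrable (fun x => Real.exp (θ * x)) μ) (x : ℝ) {δ b : ℝ} (hδ : 0 < δ)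
    (hb : 0 ≤ b) :
    mgf id μ (x * b) ≤ Real.exp (b * (x ^ 2 + |x| * δ)) * μ.real (Metric.ball x δ)
      + Real.exp (-b * δ * (x + δ)) * mgf id μ ((x + δ) * b)
      + Real.exp (b * δ * (x - δ)) * mgf id μ ((x - δ) * b) := by
  have hball : Integrable ((Metric.ball x δ).indicator fun _ => Real.exp (b * (x ^ 2 + |x| * δ)))
      μ := (integrable_const _).indicator measurableSet_ball
  have h1 := (hint ((x + δ) * b)).const_mul (Real.exp (-b * δ * (x + δ)))
  have h2 := (hint ((x - δ) * b)).const_mul (Real.exp (b * δ * (x - δ)))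
  have key : ∀ z : ℝ, Real.exp (x * b * z)
      ≤ (Metric.ball x δ).indicator (fun _ => Real.exp (b * (x ^ 2 + |x| * δ))) z
        + Real.exp (-b * δ * (x + δ)) * Real.exp ((x + δ) * b * z)
        + Real.exp (b * δ * (x - δ)) * Real.exp ((x - δ) * b * z) := by
    intro z
    rw [← Real.exp_add, ← Real.exp_add]
    have p1 := Real.exp_pos (-b * δ * (x + δ) + (x + δ) * b * z)
    have p2 := Real.exp_pos (b * δ * (x - δ) + (x - δ) * b * z)
    by_cases hz : z ∈ Metric.ball x δ
    · rw [Set.indicator_of_mem hz]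
      have : Real.exp (x * b * z) ≤ Real.exp (b * (x ^ 2 + |x| * δ)) := by
        refine Real.exp_le_exp.2 ?_
        rw [Metric.mem_ball, Real.dist_eq] at hz
        have h3 : x * (z - x) ≤ |x| * δ :=
          (le_abs_self _).trans ((abs_mul _ _).trans_le (by gcongr))
        nlinarith
      linarith
    · rw [Set.indicator_of_notMem hz]
      rw [Metric.mem_ball, Real.dist_eq, not_lt] at hz
      rcases le_abs'.1 hz with h | h
      · have : Real.exp (x * b * z) ≤ Real.exp (b * δ * (x - δ) + (x - δ) * b * z) := by
          refine Real.exp_le_exp.2 ?_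
          nlinarith [mul_nonneg (mul_nonneg hb hδ.le) (show 0 ≤ x - δ - z by linarith)]
        linarith
      · have : Real.exp (x * b * z) ≤ Real.exp (-b * δ * (x + δ) + (x + δ) * b * z) := by
          refine Real.exp_le_exp.2 ?_
          nlinarith [mul_nonneg (mul_nonneg hb hδ.le) (show 0 ≤ z - x - δ by linarith)]
        linarith
  calc mgf id μ (x * b) ≤ ∫ z, ((Metric.ball x δ).indicator
          (fun _ => Real.exp (b * (x ^ 2 + |x| * δ))) z
        + Real.exp (-b * δ * (x + δ)) * Real.exp ((x + δ) * b * z)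
        + Real.exp (b * δ * (x - δ)) * Real.exp ((x - δ) * b * z)) ∂μ :=
        integral_mono (hint _) ((hball.add h1).add h2) key
    _ = _ := by
        have e1 := integral_add (hball.add h1) h2
        have e2 := integral_add hball h1
        simp only [Pi.add_apply] at e1
        rw [e1, e2, integral_const_mul, integral_const_mul,
          integral_indicator_const _ measurableSet_ball, smul_eq_mul, mul_comm (μ.real _)]
        rfl

theorem satisfiesLDP_of_tendsto_cgf {P : ℕ → Measure ℝ} {b : ℕ → ℝ}
    (hP : ∀ᶠ n in atTop, IsProbabilityMeasure (P n))
    (hint : ∀ n, ∀ θ : ℝ, Integrable (fun x => Real.exp (θ * x)) (P n))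
    (hb : Tendsto b atTop atTop)
    (h : ∀ θ : ℝ, Tendsto (fun n => cgf id (P n) (θ * b n) / b n) atTop (𝓝 (θ ^ 2 / 2))) :
    SatisfiesLDP P b (fun x => ((x ^ 2 / 2 : ℝ) : EReal)) where
  nonneg x := by
    have : (0 : ℝ) ≤ x ^ 2 / 2 := by positivity
    exact_mod_cast this
  lowerSemicontinuous :=
    (continuous_coe_real_ereal.comp (by fun_prop : Continuous fun x : ℝ => x ^ 2 / 2)
      ).lowerSemicontinuous
  lower A _ := by
    refine le_of_forall_lt_imp_le_of_dense fun y hy => ?_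
    rw [EReal.lt_neg_comm] at hy
    simp only [iInf_lt_iff] at hy
    obtain ⟨x, hx, hxy⟩ := hy
    rw [EReal.lt_neg_comm, ← EReal.coe_neg] at hxy
    obtain ⟨c, hyc, hcx⟩ := EReal.lt_iff_exists_real_btwn.1 hxy
    rw [EReal.coe_lt_coe_iff] at hcx
    refine le_trans hyc.le (le_liminf_of_le (by isBoundedDefault) ?_)
    obtain ⟨δ₀, hδ₀, hball⟩ := Metric.isOpen_iff.1 isOpen_interior x hx
    set gap := -(x ^ 2 / 2) - c with hgap
    have hgap0 : 0 < gap := by linarith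
    -- As δ ≤ 1, the loss |x| δ + δ²/8 is at most (|x| + 1) δ, hence below the gap.
    obtain ⟨δ, hδ, hδ1, hδ2, hδ3⟩ : ∃ δ : ℝ, 0 < δ ∧ δ ≤ δ₀ ∧ δ ≤ 1 ∧ (|x| + 1) * δ < gap := by
      refine ⟨min (min δ₀ 1) (gap / (2 * (|x| + 1))), by positivity,
        (min_le_left _ _).trans (min_le_left _ _), (min_le_left _ _).trans (min_le_right _ _), ?_⟩
      have : (|x| + 1) * min (min δ₀ 1) (gap / (2 * (|x| + 1)))
          ≤ (|x| + 1) * (gap / (2 * (|x| + 1))) := by gcongr; exact min_le_right _ _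
      refine this.trans_lt ?_
      have h1 : 0 < |x| + 1 := by positivity
      rw [show (|x| + 1) * (gap / (2 * (|x| + 1))) = gap / 2 by field_simp]
      linarith
    have hη : 0 < δ ^ 2 / 8 := by positivity
    have hg2 : 0 < gap - |x| * δ - δ ^ 2 / 8 := by nlinarith
    -- The tails have limiting exponent x²/2 - δ²/2, against x²/2 for the whole. Tolerances δ²/8
    -- leave a margin δ²/4, so each tail takes at most a quarter of the lower bound and the ball
    -- keeps half.
    have e0 := (tendsto_order.1 (h x)).1 (x ^ 2 / 2 - δ ^ 2 / 8) (by linarith)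
    have e1 := (tendsto_order.1 (h (x + δ))).2 ((x + δ) ^ 2 / 2 + δ ^ 2 / 8) (by linarith)
    have e2 := (tendsto_order.1 (h (x - δ))).2 ((x - δ) ^ 2 / 2 + δ ^ 2 / 8) (by linarith)
    filter_upwards [hP, e0, e1, e2, hb.eventually_gt_atTop 0,
      (hb.atTop_mul_const (by positivity : 0 < δ ^ 2 / 4)).eventually_ge_atTop (Real.log 4),
      (hb.atTop_mul_const hg2).eventually_ge_atTop (Real.log 2)] with n hn h0 h1 h2 hb0 h3 h4
    refine le_log_div_of_le_toReal hb0 ?_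
    have key := mgf_le_measureReal_ball_add (hint n) x hδ hb0.le
    rw [← exp_cgf (X := id) (hint n _), ← exp_cgf (X := id) (hint n _),
      ← exp_cgf (X := id) (hint n _), ← Real.exp_add,
      ← Real.exp_add] at key
    rw [lt_div_iff₀ hb0] at h0
    rw [div_lt_iff₀ hb0] at h1 h2
    have k0 : Real.exp (b n * (x ^ 2 / 2 - δ ^ 2 / 8)) ≤ Real.exp (cgf id (P n) (x * b n)) :=
      Real.exp_le_exp.2 (by linarith)
    have k1 : Real.exp (-b n * δ * (x + δ) + cgf id (P n) ((x + δ) * b n))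
        ≤ Real.exp (b n * (x ^ 2 / 2 - δ ^ 2 / 8)) / 4 := by
      rw [← Real.exp_log (show (0 : ℝ) < 4 by norm_num), ← Real.exp_sub]
      exact Real.exp_le_exp.2 (by linarith)
    have k2 : Real.exp (b n * δ * (x - δ) + cgf id (P n) ((x - δ) * b n))
        ≤ Real.exp (b n * (x ^ 2 / 2 - δ ^ 2 / 8)) / 4 := by
      rw [← Real.exp_log (show (0 : ℝ) < 4 by norm_num), ← Real.exp_sub]
      exact Real.exp_le_exp.2 (by linarith)
    have k3 : Real.exp (b n * (x ^ 2 + |x| * δ)) * Real.exp (b n * c)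
        ≤ Real.exp (b n * (x ^ 2 / 2 - δ ^ 2 / 8)) / 2 := by
      rw [← Real.exp_log (show (0 : ℝ) < 2 by norm_num), ← Real.exp_sub, ← Real.exp_add]
      refine Real.exp_le_exp.2 ?_
      rw [Real.exp_log (by norm_num)]
      rw [hgap] at h4
      linarith
    have k4 : (P n).real (Metric.ball x δ) ≤ (P n).real A :=
      measureReal_mono ((Metric.ball_subset_ball hδ1).trans (hball.trans interior_subset))
    refine le_trans ?_ k4
    refine le_of_mul_le_mul_left ?_ (Real.exp_pos (b n * (x ^ 2 + |x| * δ)))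
    linarith
  upper A _ := by
    refine le_of_forall_gt_imp_ge_of_dense fun y hy => ?_
    obtain ⟨c, hc, hcy⟩ := EReal.lt_iff_exists_real_btwn.1 hy
    obtain ⟨c', hcc', hc'y⟩ := EReal.lt_iff_exists_real_btwn.1 hcy
    rw [EReal.coe_lt_coe_iff] at hcc'
    refine le_trans (limsup_le_of_le (by isBoundedDefault) ?_) hc'y.le
    -- The rate increases with |x|, so A lies outside (-r, r). For c ≥ 0 the square root is 0 and
    -- nothing is claimed.
    have hA : ∀ x ∈ A, √(-(2 * c)) ≤ |x| := by
      intro x hx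
      refine Real.sqrt_le_iff.2 ⟨abs_nonneg x, ?_⟩
      have h1 : (⨅ x ∈ closure A, ((x ^ 2 / 2 : ℝ) : EReal)) ≤ ((x ^ 2 / 2 : ℝ) : EReal) :=
        iInf₂_le x (subset_closure hx)
      have h2 := (EReal.neg_lt_comm.1 hc).trans_le h1
      rw [← EReal.coe_neg, EReal.coe_lt_coe_iff] at h2
      rw [sq_abs]
      linarith
    set r := √(-(2 * c)) with hr
    have hr0 : 0 ≤ r := Real.sqrt_nonneg _
    have hrc : -(r ^ 2 / 2) ≤ c := by
      rcases le_total 0 (-(2 * c)) with h0 | h0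
      · rw [hr, Real.sq_sqrt h0]
        linarith
      · have : r = 0 := Real.sqrt_eq_zero_of_nonpos h0
        rw [this]
        linarith
    have hη : 0 < (c' - c) / 2 := by linarith
    have e1 := (tendsto_order.1 (h r)).2 (r ^ 2 / 2 + (c' - c) / 2) (by linarith)
    have e2 := (tendsto_order.1 (h (-r))).2 (r ^ 2 / 2 + (c' - c) / 2) (by rw [neg_sq]; linarith)
    filter_upwards [hP, e1, e2, hb.eventually_gt_atTop 0,
      (hb.atTop_mul_const hη).eventually_ge_atTop (Real.log 2)] with n hn h1 h2 hb0 h3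
    refine log_div_le_of_toReal_le (measure_ne_top _ _) hb0 ?_
    refine (measureReal_le_of_forall_le_abs (hint n) hr0 hb0.le hA).trans ?_
    rw [div_lt_iff₀ hb0] at h1 h2
    have hm : b n * -(r ^ 2 / 2) ≤ b n * c := mul_le_mul_of_nonneg_left hrc hb0.le
    have k : ∀ s, s < (r ^ 2 / 2 + (c' - c) / 2) * b n →
        Real.exp (-(r * b n) * r + s) ≤ Real.exp (b n * c') / 2 := by
      intro s hs
      rw [← Real.exp_log (show (0 : ℝ) < 2 by norm_num), ← Real.exp_sub]
      exact Real.exp_le_exp.2 (by linarith)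
    linarith [k _ h1, k _ h2]

/-! ### Elementary inequalities -/

theorem abs_exp_sub_one_le_mul_exp (x : ℝ) : |Real.exp x - 1| ≤ |x| * Real.exp |x| := by
  have h := Complex.norm_exp_sub_sum_le_norm_mul_exp x 1
  simp only [Finset.range_one, Finset.sum_singleton, pow_zero, Nat.factorial_zero, Nat.cast_one,
    div_one, pow_one, Complex.norm_real, Real.norm_eq_abs] at h
  rwa [← Complex.ofReal_exp, ← Complex.ofReal_one, ← Complex.ofReal_sub, Complex.norm_real,
    Real.norm_eq_abs] at h

theorem abs_exp_sub_one_sub_le_sq_mul_exp (x : ℝ) :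
    |Real.exp x - 1 - x| ≤ x ^ 2 * Real.exp |x| := by
  have h := Complex.norm_exp_sub_sum_le_norm_mul_exp x 2
  simp only [Finset.sum_range_succ, Finset.range_zero, Finset.sum_empty, pow_zero,
    Nat.factorial, Nat.cast_one, div_one, pow_one, Complex.norm_real, Real.norm_eq_abs, zero_add,
    mul_one, sq_abs] at h
  rw [← Complex.ofReal_exp, ← Complex.ofReal_one, ← Complex.ofReal_add, ← Complex.ofReal_sub,
    Complex.norm_real, Real.norm_eq_abs] at h
  rwa [sub_sub]

theorem abs_exp_sub_quadratic_le (x : ℝ) :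
    |Real.exp x - 1 - x - x ^ 2 / 2| ≤ |x| ^ 3 * Real.exp |x| := by
  have h := Complex.norm_exp_sub_sum_le_norm_mul_exp x 3
  have e : Complex.exp x - ∑ m ∈ Finset.range 3, (x : ℂ) ^ m / m.factorial
      = ((Real.exp x - 1 - x - x ^ 2 / 2 : ℝ) : ℂ) := by
    simp only [Finset.sum_range_succ, Finset.range_zero, Finset.sum_empty, Nat.factorial]
    push_cast
    ring
  rwa [e, Complex.norm_real, Complex.norm_real, Real.norm_eq_abs, Real.norm_eq_abs] at h

theorem abs_log_one_add_sub_le {u : ℝ} (hu : -(1 / 2) ≤ u) :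
    |Real.log (1 + u) - u| ≤ 2 * u ^ 2 := by
  have h0 : 0 < 1 + u := by linarith
  have h1 := Real.log_le_sub_one_of_pos h0
  have h2 := Real.one_sub_inv_le_log_of_pos h0
  have h3 : u - 2 * u ^ 2 ≤ 1 - (1 + u)⁻¹ := by
    have : 1 - (1 + u)⁻¹ = u / (1 + u) := by field_simp; ring
    rw [this, le_div_iff₀ h0]
    nlinarith [mul_nonneg (sq_nonneg u) (show 0 ≤ 1 + 2 * u by linarith)]
  rw [abs_le]
  constructor <;> nlinarith [sq_nonneg u]

theorem neg_two_mul_abs_le_log_one_add {u : ℝ} (hu : -(1 / 2) ≤ u) :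
    -(2 * |u|) ≤ Real.log (1 + u) := by
  have h0 : 0 < 1 + u := by linarith
  refine le_trans ?_ (Real.one_sub_inv_le_log_of_pos h0)
  have : 1 - (1 + u)⁻¹ = u / (1 + u) := by field_simp; ring
  rw [this, le_div_iff₀ h0]
  rcases le_total 0 u with h | h
  · rw [abs_of_nonneg h]
    nlinarith
  · rw [abs_of_nonpos h]
    nlinarith [mul_nonneg (neg_nonneg.2 h) (show 0 ≤ 1 + 2 * u by linarith)]

theorem abs_le_exp_abs (x : ℝ) : |x| ≤ Real.exp |x| := by
  linarith [Real.add_one_le_exp |x|]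

/-! ### The independent model -/

/-- Since p ≥ 2, the Euler factors stay away from 0 however negative the exponent. -/
theorem neg_half_le_exp_sub_one_div (x : ℝ) {p : ℕ} (hp : 2 ≤ p) :
    -(1 / 2) ≤ (Real.exp x - 1) / p := by
  have hp1 : (2 : ℝ) ≤ p := by exact_mod_cast hp
  rw [le_div_iff₀ (by linarith)]
  linarith [Real.exp_pos x]

/-- The moment generating function of the independent model. -/
noncomputable def indepProd (w : ℕ → ℝ) (n : ℕ) : ℝ :=
  ∏ p ∈ Nat.primesLE n, (1 + (Real.exp (w p) - 1) / p)

theorem one_add_exp_sub_one_div_pos (x : ℝ) {n p : ℕ} (hp : p ∈ Nat.primesLE n) :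
    0 < 1 + (Real.exp x - 1) / p := by
  linarith [neg_half_le_exp_sub_one_div x (Nat.two_le_of_mem_primesLE hp)]

theorem indepProd_pos (w : ℕ → ℝ) (n : ℕ) : 0 < indepProd w n :=
  Finset.prod_pos fun _ hp => one_add_exp_sub_one_div_pos _ hp

theorem log_indepProd (w : ℕ → ℝ) (n : ℕ) :
    Real.log (indepProd w n) = ∑ p ∈ Nat.primesLE n, Real.log (1 + (Real.exp (w p) - 1) / p) :=
  Real.log_prod fun _ hp => (one_add_exp_sub_one_div_pos _ hp).ne'

/-- The cubic error comes from expanding the exponential, the one with p² from log(1 + u) = u +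
O(u²). -/
theorem abs_log_indepProd_sub_le (w : ℕ → ℝ) (n : ℕ) :
    |Real.log (indepProd w n) - ∑ p ∈ Nat.primesLE n, w p / p
        - (∑ p ∈ Nat.primesLE n, w p ^ 2 / p) / 2|
      ≤ ∑ p ∈ Nat.primesLE n, |w p| ^ 3 * Real.exp |w p| / p
        + 2 * ∑ p ∈ Nat.primesLE n, w p ^ 2 * Real.exp (2 * |w p|) / p ^ 2 := by
  rw [log_indepProd, Finset.sum_div, ← Finset.sum_sub_distrib, ← Finset.sum_sub_distrib,
    Finset.mul_sum, ← Finset.sum_add_distrib]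
  refine (Finset.abs_sum_le_sum_abs _ _).trans (Finset.sum_le_sum fun p hp => ?_)
  have hp0 : (0 : ℝ) < p := by exact_mod_cast (Nat.prime_of_mem_primesLE hp).pos
  have h1 := abs_log_one_add_sub_le
    (neg_half_le_exp_sub_one_div (w p) (Nat.two_le_of_mem_primesLE hp))
  have h2 : |(Real.exp (w p) - 1) / p - w p / p - w p ^ 2 / p / 2|
      ≤ |w p| ^ 3 * Real.exp |w p| / p := by
    rw [show (Real.exp (w p) - 1) / p - w p / p - w p ^ 2 / p / 2
      = (Real.exp (w p) - 1 - w p - w p ^ 2 / 2) / p by ring, abs_div, abs_of_pos hp0]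
    exact div_le_div_of_nonneg_right (abs_exp_sub_quadratic_le _) hp0.le
  have h3 : ((Real.exp (w p) - 1) / p) ^ 2 ≤ w p ^ 2 * Real.exp (2 * |w p|) / p ^ 2 := by
    rw [div_pow]
    refine div_le_div_of_nonneg_right ?_ (by positivity)
    calc _ = |Real.exp (w p) - 1| ^ 2 := (sq_abs _).symm
      _ ≤ (|w p| * Real.exp |w p|) ^ 2 := by gcongr; exact abs_exp_sub_one_le_mul_exp _
      _ = _ := by rw [mul_pow, sq_abs, ← Real.exp_nat_mul]; norm_num
  rw [abs_le] at h1 h2 ⊢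
  constructor <;> linarith [h1.1, h1.2, h2.1, h2.2]

theorem neg_two_mul_sum_le_log_indepProd (w : ℕ → ℝ) (n : ℕ) :
    -(2 * ∑ p ∈ Nat.primesLE n, |w p| * Real.exp |w p| / p) ≤ Real.log (indepProd w n) := by
  rw [log_indepProd, Finset.mul_sum, ← Finset.sum_neg_distrib]
  refine Finset.sum_le_sum fun p hp => le_trans ?_ (neg_two_mul_abs_le_log_one_add
    (neg_half_le_exp_sub_one_div (w p) (Nat.two_le_of_mem_primesLE hp)))
  rw [abs_div, Nat.abs_cast]
  have := div_le_div_of_nonneg_right (abs_exp_sub_one_le_mul_exp (w p)) (Nat.cast_nonneg (α := ℝ) p)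
  linarith

/-! ### Convexity -/

theorem meanExp_pos (w : ℕ → ℝ) {n : ℕ} (hn : 1 ≤ n) : 0 < meanExp w n := by
  have hn0 : (0 : ℝ) < n := by exact_mod_cast hn
  exact div_pos (Finset.sum_pos (fun _ _ => Real.exp_pos _)
    ⟨1, Finset.mem_Ioc.2 ⟨one_pos, hn⟩⟩) hn0

/-- Hölder's inequality: normalize both means to 1 and apply convexity of exp termwise. -/
theorem log_meanExp_convex (v w : ℕ → ℝ) {α β : ℝ} (hα : 0 ≤ α) (hβ : 0 ≤ β) (h : α + β = 1)
    {n : ℕ} (hn : 1 ≤ n) :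
    Real.log (meanExp (fun p => α * v p + β * w p) n)
      ≤ α * Real.log (meanExp v n) + β * Real.log (meanExp w n) := by
  have hn0 : (0 : ℝ) < n := by exact_mod_cast hn
  set A := Real.log (meanExp v n) with hA
  set B := Real.log (meanExp w n) with hB
  have eA : (∑ m ∈ Finset.Ioc 0 n, Real.exp (primeSum v m)) = n * Real.exp A := by
    rw [hA, Real.exp_log (meanExp_pos v hn), meanExp]
    field_simp
  have eB : (∑ m ∈ Finset.Ioc 0 n, Real.exp (primeSum w m)) = n * Real.exp B := by
    rw [hB, Real.exp_log (meanExp_pos w hn), meanExp]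
    field_simp
  rw [Real.log_le_iff_le_exp (meanExp_pos _ hn), meanExp, div_le_iff₀ hn0]
  calc ∑ m ∈ Finset.Ioc 0 n, Real.exp (primeSum (fun p => α * v p + β * w p) m)
      ≤ ∑ m ∈ Finset.Ioc 0 n, Real.exp (α * A + β * B)
          * (α * (Real.exp (primeSum v m) * Real.exp (-A))
            + β * (Real.exp (primeSum w m) * Real.exp (-B))) := by
        refine Finset.sum_le_sum fun m _ => ?_
        have := convexOn_exp.2 (Set.mem_univ (primeSum v m - A)) (Set.mem_univ (primeSum w m - B))
          hα hβ h
        simp only [smul_eq_mul, sub_eq_add_neg, Real.exp_add] at this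
        rw [primeSum_add, primeSum_const_mul, primeSum_const_mul,
          show α * primeSum v m + β * primeSum w m = (α * A + β * B)
            + (α * (primeSum v m + -A) + β * (primeSum w m + -B)) by ring, Real.exp_add (α * A + _),
            Real.exp_add (α * (primeSum v m + -A))]
        gcongr
    _ = _ := by
        rw [← Finset.mul_sum, Finset.sum_add_distrib, ← Finset.mul_sum, ← Finset.mul_sum,
          ← Finset.sum_mul, ← Finset.sum_mul, eA, eB, mul_assoc, mul_assoc, ← Real.exp_add,
          ← Real.exp_add, add_neg_cancel, add_neg_cancel, Real.exp_zero]
        linear_combination (Real.exp (α * A + β * B) * n) * h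

/-! ### Splitting the primes into small and large ones -/

/-- For |s| ≤ 1 the powers of s can be pulled out, while powers of |x| are absorbed by larger
exponentials. -/
theorem abs_mul_mul_exp_le {s x : ℝ} (hs : |s| ≤ 1) :
    |s * x| * Real.exp |s * x| ≤ |s| * Real.exp (2 * |x|) := by
  calc _ ≤ |s| * Real.exp |x| * Real.exp |x| := by
        rw [abs_mul s x]
        gcongr
        · exact abs_le_exp_abs x
        · exact mul_le_of_le_one_left (abs_nonneg x) hs
    _ = _ := by rw [mul_assoc, ← Real.exp_add]; ring_nf

theorem sq_mul_exp_le {s x : ℝ} (hs : |s| ≤ 1) :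
    (s * x) ^ 2 * Real.exp (2 * |s * x|) ≤ s ^ 2 * Real.exp (4 * |x|) := by
  have h := pow_le_pow_left₀ (by positivity) (abs_mul_mul_exp_le (x := x) hs) 2
  rw [mul_pow, mul_pow, sq_abs, sq_abs, ← Real.exp_nat_mul, ← Real.exp_nat_mul] at h
  rw [show 4 * |x| = ((2 : ℕ) : ℝ) * (2 * |x|) by push_cast; ring]
  push_cast at h ⊢
  exact h

theorem cube_mul_exp_le {s x : ℝ} (hs : |s| ≤ 1) :
    |s * x| ^ 3 * Real.exp |s * x| ≤ |s| ^ 3 * Real.exp (8 * |x|) := by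
  calc _ ≤ |s| ^ 3 * Real.exp |x| ^ 3 * Real.exp |x| := by
        rw [abs_mul s x, mul_pow]
        gcongr
        · exact abs_le_exp_abs x
        · exact mul_le_of_le_one_left (abs_nonneg x) hs
    _ = |s| ^ 3 * Real.exp (4 * |x|) := by
        rw [mul_assoc, ← Real.exp_nat_mul, ← Real.exp_add]
        push_cast
        ring_nf
    _ ≤ _ := by gcongr; norm_num

theorem sq_le_exp_four_mul (x : ℝ) : x ^ 2 ≤ Real.exp (4 * |x|) := by
  calc x ^ 2 = |x| ^ 2 := (sq_abs x).symm
    _ ≤ Real.exp |x| ^ 2 := by gcongr; exact abs_le_exp_abs x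
    _ = Real.exp (2 * |x|) := by rw [← Real.exp_nat_mul]; norm_num
    _ ≤ _ := by gcongr; norm_num

/-- `∑_{p ≤ n} exp (8 |g(p)|) / p`. -/
noncomputable def expSum (g : ℕ → ℝ) (n : ℕ) : ℝ :=
  ∑ p ∈ Nat.primesLE n, Real.exp (8 * |g p|) / p

/-- `∑_{p ≤ n} exp (4 |g(p)|) / p ^ 2`. -/
noncomputable def expSqSum (g : ℕ → ℝ) (n : ℕ) : ℝ :=
  ∑ p ∈ Nat.primesLE n, Real.exp (4 * |g p|) / p ^ 2

/-- `∑_{p ≤ n, p ∉ S} exp (4 |g(p)|) / p`. -/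
noncomputable def expSumCompl (g : ℕ → ℝ) (S : Set ℕ) (n : ℕ) : ℝ :=
  ∑ p ∈ Nat.primesLE n, Sᶜ.indicator (fun p => Real.exp (4 * |g p|) / p) p

theorem expSum_nonneg (g : ℕ → ℝ) (n : ℕ) : 0 ≤ expSum g n :=
  Finset.sum_nonneg fun _ _ => by positivity

theorem expSqSum_nonneg (g : ℕ → ℝ) (n : ℕ) : 0 ≤ expSqSum g n :=
  Finset.sum_nonneg fun _ _ => by positivity

theorem expSumCompl_nonneg (g : ℕ → ℝ) (S : Set ℕ) (n : ℕ) : 0 ≤ expSumCompl g S n :=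
  Finset.sum_nonneg fun _ _ => Set.indicator_nonneg (fun _ _ => by positivity) _

/-- The full variance stands in for that of S; the primes outside S account for the term
`expSumCompl`. -/
theorem abs_log_indepProd_indicator_sub_le (g : ℕ → ℝ) (S : Set ℕ) (n : ℕ) {s : ℝ}
    (hs : |s| ≤ 1) :
    |Real.log (indepProd (S.indicator fun p => s * g p) n)
        - ∑ p ∈ Nat.primesLE n, S.indicator (fun p => s * g p) p / p - s ^ 2 * varSum g n / 2|
      ≤ s ^ 2 * (2 * expSqSum g n + |s| * expSum g n + expSumCompl g S n) := by
  have h1 := abs_log_indepProd_sub_le (S.indicator fun p => s * g p) n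
  set w := S.indicator fun p => s * g p with hw
  have hS : ∀ p ∈ S, w p = s * g p := fun p hp => Set.indicator_of_mem hp _
  have hS' : ∀ p ∉ S, w p = 0 := fun p hp => Set.indicator_of_notMem hp _
  have h2 : ∑ p ∈ Nat.primesLE n, |w p| ^ 3 * Real.exp |w p| / p ≤ |s| ^ 3 * expSum g n := by
    rw [expSum, Finset.mul_sum]
    refine Finset.sum_le_sum fun p _ => ?_
    by_cases hp : p ∈ S
    · rw [hS p hp, ← mul_div_assoc]
      exact div_le_div_of_nonneg_right (cube_mul_exp_le hs) (Nat.cast_nonneg _)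
    · rw [hS' p hp]
      simp only [abs_zero, ne_eq, OfNat.ofNat_ne_zero, not_false_eq_true, zero_pow, zero_mul,
        zero_div]
      positivity
  have h3 : ∑ p ∈ Nat.primesLE n, w p ^ 2 * Real.exp (2 * |w p|) / p ^ 2
      ≤ s ^ 2 * expSqSum g n := by
    rw [expSqSum, Finset.mul_sum]
    refine Finset.sum_le_sum fun p _ => ?_
    by_cases hp : p ∈ S
    · rw [hS p hp, ← mul_div_assoc]
      exact div_le_div_of_nonneg_right (sq_mul_exp_le hs) (by positivity)
    · rw [hS' p hp]
      simp only [abs_zero, ne_eq, OfNat.ofNat_ne_zero, not_false_eq_true, zero_pow, zero_mul,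
        zero_div]
      positivity
  have h4 : s ^ 2 * varSum g n - ∑ p ∈ Nat.primesLE n, w p ^ 2 / p
      = s ^ 2 * ∑ p ∈ Nat.primesLE n, Sᶜ.indicator (fun p => g p ^ 2 / p) p := by
    rw [varSum, Finset.mul_sum, Finset.mul_sum, ← Finset.sum_sub_distrib]
    refine Finset.sum_congr rfl fun p _ => ?_
    by_cases hp : p ∈ S
    · rw [hS p hp, Set.indicator_of_notMem (by simpa using hp)]
      ring
    · rw [hS' p hp, Set.indicator_of_mem (by simpa using hp)]
      ring
  have h5 : ∑ p ∈ Nat.primesLE n, Sᶜ.indicator (fun p => g p ^ 2 / p) p ≤ expSumCompl g S n := by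
    refine Finset.sum_le_sum fun p _ => Set.indicator_le_indicator ?_
    exact div_le_div_of_nonneg_right (sq_le_exp_four_mul _) (Nat.cast_nonneg _)
  have h6 : 0 ≤ ∑ p ∈ Nat.primesLE n, Sᶜ.indicator (fun p => g p ^ 2 / p) p :=
    Finset.sum_nonneg fun _ _ => Set.indicator_nonneg (fun _ _ => by positivity) _
  have h7 : |s| ^ 3 = s ^ 2 * |s| := by rw [← sq_abs]; ring
  have h8 := mul_le_mul_of_nonneg_left h5 (sq_nonneg s)
  have h9 := mul_nonneg (sq_nonneg s) h6
  rw [h7] at h2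
  rw [abs_le] at h1 ⊢
  constructor <;> nlinarith [h1.1, h1.2]

/-- The prime numbers `p` with `p ^ κ ≤ e`. -/
def smallPrimes (κ : ℝ) : Set ℕ := {p | (p : ℝ) ^ κ ≤ Real.exp 1}

/-- Rankin's trick with n^(-κ) = exp(-3L): on S the factor p^κ is at most 3, so the error is smaller
than the product itself. -/
theorem abs_log_meanExp_small_sub_le (g : ℕ → ℝ) {n : ℕ} (hn : 2 ≤ n) {s : ℝ} (hs : |s| ≤ 1)
    (h1 : 1 ≤ primeHarmonic n) (hlog : 3 * primeHarmonic n ≤ Real.log n)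
    (hV : 5 * (|s| * expSum g n) ≤ primeHarmonic n) {S : Set ℕ}
    (hSd : S = smallPrimes (3 * primeHarmonic n / Real.log n)) :
    |Real.log (meanExp (S.indicator fun p => s * g p) n)
        - ∑ p ∈ Nat.primesLE n, S.indicator (fun p => s * g p) p / p - s ^ 2 * varSum g n / 2|
      ≤ Real.log 2
        + s ^ 2 * (2 * expSqSum g n + |s| * expSum g n + expSumCompl g S n) := by
  have hn1 : (2 : ℝ) ≤ n := by exact_mod_cast hn
  have hn0 : (0 : ℝ) < n := by linarith
  have l0 : 0 < Real.log n := Real.log_pos (by linarith)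
  have hI := abs_log_indepProd_indicator_sub_le g S n hs
  set w := S.indicator fun p => s * g p with hw
  set κ := 3 * primeHarmonic n / Real.log n with hκ
  have hR := abs_meanExp_sub_prod_le w (n := n) (by omega) (κ := κ) (by positivity)
    ((div_le_one l0).2 hlog)
  have hS : ∀ p ∈ S, w p = s * g p := fun p hp => Set.indicator_of_mem hp _
  have hS' : ∀ p ∉ S, w p = 0 := fun p hp => Set.indicator_of_notMem hp _
  have e1 : (n : ℝ) ^ (-κ) = Real.exp (-(3 * primeHarmonic n)) := by
    rw [Real.rpow_def_of_pos hn0, hκ]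
    congr 1
    field_simp
  have hle : ∀ p, |w p| * Real.exp |w p| ≤ |s| * Real.exp (8 * |g p|) := by
    intro p
    by_cases hp : p ∈ S
    · rw [hS p hp]
      refine (abs_mul_mul_exp_le hs).trans ?_
      gcongr
      norm_num
    · rw [hS' p hp]
      simp only [abs_zero, zero_mul]
      positivity
  have b1 : ∑ p ∈ Nat.primesLE n, |w p| * Real.exp |w p| / p ≤ |s| * expSum g n := by
    rw [expSum, Finset.mul_sum]
    refine Finset.sum_le_sum fun p _ => ?_
    rw [← mul_div_assoc]
    exact div_le_div_of_nonneg_right (hle p) (Nat.cast_nonneg _)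
  have b2 : ∑ p ∈ Nat.primesLE n, |Real.exp (w p) - 1| * (p : ℝ) ^ κ / p
      ≤ 3 * (|s| * expSum g n) := by
    rw [expSum, Finset.mul_sum, Finset.mul_sum]
    refine Finset.sum_le_sum fun p _ => ?_
    rw [← mul_div_assoc, ← mul_div_assoc]
    refine div_le_div_of_nonneg_right ?_ (Nat.cast_nonneg _)
    by_cases hp : p ∈ S
    · have hpk : (p : ℝ) ^ κ ≤ 3 := by
        rw [hSd] at hp
        exact le_trans hp (by linarith [Real.exp_one_lt_d9])
      calc _ ≤ |s| * Real.exp (8 * |g p|) * 3 := by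
            gcongr
            exact (abs_exp_sub_one_le_mul_exp _).trans (hle p)
        _ = _ := by ring
    · rw [hS' p hp]
      simp only [Real.exp_zero, sub_self, abs_zero, zero_mul]
      positivity
  have b3 := neg_two_mul_sum_le_log_indepProd w n
  have hU := indepProd_pos w n
  set U := indepProd w n with hUdef
  -- With E = |s| `expSum g n`, the error is at most exp(3E - 3L) and log U ≥ -2E. So 5E + log 2 ≤
  -- 3L suffices, and 5E ≤ L and L ≥ 1 ensure it.
  have b4 : |meanExp w n - U| ≤ U / 2 := by
    refine hR.trans ?_
    rw [e1, ← Real.exp_add]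
    calc _ ≤ Real.exp (Real.log U - Real.log 2) := by
          refine Real.exp_le_exp.2 ?_
          have := Real.log_two_lt_d9
          linarith
      _ = U / 2 := by rw [Real.exp_sub, Real.exp_log hU, Real.exp_log two_pos]
  have hM := meanExp_pos w (n := n) (by omega)
  have b5 : |Real.log (meanExp w n) - Real.log U| ≤ Real.log 2 := by
    rw [abs_le] at b4 ⊢
    constructor
    · have := Real.log_le_log (half_pos hU) (show U / 2 ≤ meanExp w n by linarith [b4.1])
      rw [Real.log_div hU.ne' two_ne_zero] at this
      linarith
    · have := Real.log_le_log hM (show meanExp w n ≤ U * 2 by linarith [b4.2])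
      rw [Real.log_mul hU.ne' two_ne_zero] at this
      linarith
  rw [abs_le] at b5 hI ⊢
  constructor <;> linarith [b5.1, b5.2, hI.1, hI.2]

/-- The linear term of (exp(2w) - 1)/2 is exactly w, so centering leaves a quadratic remainder
supported outside S. -/
theorem exists_log_meanExp_large_le (g : ℕ → ℝ) :
    ∃ C, ∀ n : ℕ, 2 ≤ n → ∀ s : ℝ, |s| ≤ 1 → ∀ S : Set ℕ,
      Real.log (meanExp (Sᶜ.indicator fun p => s * g p) n)
          - ∑ p ∈ Nat.primesLE n, Sᶜ.indicator (fun p => s * g p) p / p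
        ≤ C + s ^ 2 * (2 * expSumCompl g S n) := by
  obtain ⟨C, hC⟩ := exists_meanExp_le
  refine ⟨C / 2, fun n hn s hs S => ?_⟩
  set w := Sᶜ.indicator fun p => s * g p with hw
  have h1 := Real.log_le_log (meanExp_pos w (by omega)) (hC w n hn)
  rw [Real.log_exp] at h1
  have h2 : ∑ p ∈ Nat.primesLE n, (Real.exp (2 * w p) - 1) / p / 2
      ≤ ∑ p ∈ Nat.primesLE n, (w p / p + s ^ 2 * (2 *
        Sᶜ.indicator (fun p => Real.exp (4 * |g p|) / p) p)) := by
    refine Finset.sum_le_sum fun p _ => ?_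
    by_cases hp : p ∈ Sᶜ
    · rw [hw, Set.indicator_of_mem hp, Set.indicator_of_mem hp]
      have h3 := (abs_le.1 (abs_exp_sub_one_sub_le_sq_mul_exp (2 * (s * g p)))).2
      rw [abs_mul, abs_two] at h3
      have h4 := sq_mul_exp_le (x := g p) hs
      rw [← mul_div_assoc, ← mul_div_assoc, div_right_comm, ← add_div]
      refine div_le_div_of_nonneg_right ?_ (Nat.cast_nonneg _)
      linarith
    · rw [hw, Set.indicator_of_notMem hp, Set.indicator_of_notMem hp]
      simp
  rw [Finset.sum_add_distrib, ← Finset.mul_sum, ← Finset.mul_sum, ← Finset.sum_div] at h2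
  unfold expSumCompl
  linarith

/-! ### Asymptotics of sums over primes -/

theorem tendsto_primeHarmonic_atTop : Tendsto primeHarmonic atTop atTop := by
  have h1 : Tendsto (fun n : ℕ => Real.log (Real.log (n + 1 : ℕ)) - 1) atTop atTop :=
    tendsto_atTop_add_const_right _ _ (Real.tendsto_log_atTop.comp
      (Real.tendsto_log_atTop.comp (tendsto_natCast_atTop_atTop.comp (tendsto_add_atTop_nat 1))))
  refine tendsto_atTop_mono' _ ?_ h1
  filter_upwards [eventually_ge_atTop 1] with n hn
  have l0 : 0 < Real.log ((n + 1 : ℕ) : ℝ) := Real.log_pos (by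
    push_cast
    have : (1 : ℝ) ≤ n := by exact_mod_cast hn
    linarith)
  have := (Real.log_le_iff_le_exp l0).2 (log_succ_le_exp_primeHarmonic n)
  linarith

theorem log_log_le_primeHarmonic_floor {z : ℝ} (hz : 1 < z) :
    Real.log (Real.log z) ≤ primeHarmonic ⌊z⌋₊ + 1 := by
  have l0 : 0 < Real.log z := Real.log_pos hz
  rw [Real.log_le_iff_le_exp l0]
  refine le_trans (Real.log_le_log (by linarith) ?_) (log_succ_le_exp_primeHarmonic _)
  push_cast
  exact (Nat.lt_floor_add_one z).le

/-- The exponent defining the small primes among those up to `n`. -/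
noncomputable def cutoff (n : ℕ) : ℝ := 3 * primeHarmonic n / Real.log n

/-- The sum of the reciprocals of the large primes up to `n`. -/
noncomputable def largeHarmonic (n : ℕ) : ℝ :=
  ∑ p ∈ Nat.primesLE n, (smallPrimes (cutoff n))ᶜ.indicator (fun p : ℕ => (p : ℝ)⁻¹) p

theorem largeHarmonic_nonneg (n : ℕ) : 0 ≤ largeHarmonic n :=
  Finset.sum_nonneg fun _ _ => Set.indicator_nonneg (fun _ _ => by positivity) _

/-- Large primes exceed z = exp(1/κ) = n^(1/(3L)), and log log n - log log z = log(3L); both Mertens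
bounds are used. -/
theorem exists_largeHarmonic_le :
    ∃ C, ∀ n : ℕ, 2 ≤ n → 1 ≤ primeHarmonic n →
      largeHarmonic n ≤ Real.log (3 * primeHarmonic n) + C := by
  obtain ⟨C, hC⟩ := exists_primeHarmonic_le
  refine ⟨C + 1, fun n hn hL => ?_⟩
  have hn1 : (2 : ℝ) ≤ n := by exact_mod_cast hn
  have hn0 : (0 : ℝ) < n := by linarith
  have l0 : 0 < Real.log n := Real.log_pos (by linarith)
  have hκ : 0 < cutoff n := by unfold cutoff; positivity
  set z := Real.exp (cutoff n)⁻¹ with hz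
  have hz1 : 1 < z := Real.one_lt_exp_iff.2 (inv_pos.2 hκ)
  have hlz : Real.log (Real.log z) = Real.log (Real.log n) - Real.log (3 * primeHarmonic n) := by
    rw [hz, Real.log_exp, cutoff, inv_div, Real.log_div l0.ne' (by positivity)]
  have hzn : z ≤ n := by
    rw [← Real.exp_log hn0, hz]
    refine Real.exp_le_exp.2 ?_
    rw [cutoff, inv_div]
    exact div_le_self l0.le (by linarith)
  have hN : ⌊z⌋₊ ≤ n := Nat.floor_le_of_le hzn
  have hmem : ∀ p ∈ Nat.primesLE ⌊z⌋₊, p ∈ smallPrimes (cutoff n) := by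
    intro p hp
    have h1 : (p : ℝ) ≤ z :=
      (Nat.le_floor_iff (by positivity)).1 (Nat.le_of_mem_primesLE hp)
    calc (p : ℝ) ^ cutoff n ≤ z ^ cutoff n := Real.rpow_le_rpow (Nat.cast_nonneg _) h1 hκ.le
      _ = Real.exp 1 := by rw [hz, ← Real.exp_mul, inv_mul_cancel₀ hκ.ne']
  have hsum : largeHarmonic n + primeHarmonic ⌊z⌋₊ ≤ primeHarmonic n := by
    have h1 : primeHarmonic ⌊z⌋₊ ≤ ∑ p ∈ Nat.primesLE n,
        (smallPrimes (cutoff n)).indicator (fun p : ℕ => (p : ℝ)⁻¹) p := by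
      calc _ = ∑ p ∈ Nat.primesLE ⌊z⌋₊,
            (smallPrimes (cutoff n)).indicator (fun p : ℕ => (p : ℝ)⁻¹) p :=
            Finset.sum_congr rfl fun p hp => (Set.indicator_of_mem (hmem p hp) _).symm
        _ ≤ _ := Finset.sum_le_sum_of_subset_of_nonneg (Nat.primesLE_mono hN)
            fun _ _ _ => Set.indicator_nonneg (fun _ _ => by positivity) _
    have h2 : primeHarmonic n = ∑ p ∈ Nat.primesLE n,
          (smallPrimes (cutoff n)).indicator (fun p : ℕ => (p : ℝ)⁻¹) p + largeHarmonic n := by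
      rw [largeHarmonic, ← Finset.sum_add_distrib]
      exact Finset.sum_congr rfl fun p _ =>
        (Set.indicator_self_add_compl_apply _ (fun p : ℕ => (p : ℝ)⁻¹) p).symm
    linarith
  have h3 := log_log_le_primeHarmonic_floor hz1
  rw [hlz] at h3
  linarith [hC n hn]

theorem tendsto_largeHarmonic_div :
    Tendsto (fun n => largeHarmonic n / primeHarmonic n) atTop (𝓝 0) := by
  obtain ⟨C, hC⟩ := exists_largeHarmonic_le
  have hT := tendsto_primeHarmonic_atTop
  have h1 : Tendsto (fun n => (Real.log (3 * primeHarmonic n) + C) / primeHarmonic n) atTop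
      (𝓝 0) := by
    have h2 : Tendsto (fun x : ℝ => (Real.log x + (Real.log 3 + C)) / x) atTop (𝓝 0) := by
      have := (Real.isLittleO_log_id_atTop.tendsto_div_nhds_zero).add
        (tendsto_const_nhds (x := Real.log 3 + C)|>.div_atTop tendsto_id)
      simpa only [add_div, add_zero, id] using this
    refine (h2.comp hT).congr' ?_
    filter_upwards [hT.eventually_gt_atTop 0] with n hn
    simp only [Function.comp_apply]
    rw [Real.log_mul (by norm_num) hn.ne']
    ring
  refine tendsto_of_tendsto_of_tendsto_of_le_of_le' tendsto_const_nhds h1 ?_ ?_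
  · filter_upwards [hT.eventually_gt_atTop 0] with n hn
    exact div_nonneg (largeHarmonic_nonneg n) hn.le
  · filter_upwards [hT.eventually_ge_atTop 1, eventually_ge_atTop 2] with n hn h2
    exact div_le_div_of_nonneg_right (hC n h2 hn) (by linarith)

theorem eventually_mul_primeHarmonic_le_log :
    ∀ᶠ n : ℕ in atTop, 3 * primeHarmonic n ≤ Real.log n := by
  obtain ⟨C, hC⟩ := exists_primeHarmonic_le
  have h1 : Tendsto (fun x : ℝ => (Real.log x + C) / x) atTop (𝓝 0) := by
    have := (Real.isLittleO_log_id_atTop.tendsto_div_nhds_zero).add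
      (tendsto_const_nhds (x := C)|>.div_atTop tendsto_id)
    simpa only [add_div, add_zero, id] using this
  have h2 := Real.tendsto_log_atTop.comp (tendsto_natCast_atTop_atTop (R := ℝ))
  filter_upwards [((tendsto_order.1 (h1.comp h2)).2 (1 / 3) (by norm_num)),
    h2.eventually_gt_atTop 0, eventually_ge_atTop 2] with n h3 h4 h5
  simp only [Function.comp_apply] at h3 h4
  rw [div_lt_iff₀ h4] at h3
  linarith [hC n h5]

/-- Cauchy–Schwarz, which turns exp(4|g|) into exp(8|g|) and isolates the sparse set of large
primes. -/
theorem expSumCompl_sq_le (g : ℕ → ℝ) (n : ℕ) :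
    expSumCompl g (smallPrimes (cutoff n)) n ^ 2 ≤ expSum g n * largeHarmonic n := by
  set S := smallPrimes (cutoff n)
  have h := Finset.sum_mul_sq_le_sq_mul_sq (Nat.primesLE n)
    (fun p => Real.exp (4 * |g p|) / √p) (Sᶜ.indicator fun p : ℕ => (√p)⁻¹)
  calc _ = (∑ p ∈ Nat.primesLE n,
        Real.exp (4 * |g p|) / √p * Sᶜ.indicator (fun p : ℕ => (√p)⁻¹) p) ^ 2 := by
        unfold expSumCompl
        congr 1
        refine Finset.sum_congr rfl fun p _ => ?_
        by_cases hp : p ∈ Sᶜ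
        · rw [Set.indicator_of_mem hp, Set.indicator_of_mem hp, div_mul_eq_mul_div, mul_div_assoc,
            inv_eq_one_div, div_div, Real.mul_self_sqrt (Nat.cast_nonneg p), mul_one_div]
        · rw [Set.indicator_of_notMem hp, Set.indicator_of_notMem hp, mul_zero]
    _ ≤ _ := h
    _ = _ := by
        unfold expSum largeHarmonic
        congr 1
        · refine Finset.sum_congr rfl fun p _ => ?_
          rw [div_pow, Real.sq_sqrt (Nat.cast_nonneg p), ← Real.exp_nat_mul]
          push_cast
          ring_nf
        · refine Finset.sum_congr rfl fun p _ => ?_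
          by_cases hp : p ∈ Sᶜ
          · rw [Set.indicator_of_mem hp, Set.indicator_of_mem hp, inv_pow,
              Real.sq_sqrt (Nat.cast_nonneg p)]
          · rw [Set.indicator_of_notMem hp, Set.indicator_of_notMem hp]
            simp

theorem expSqSum_sq_le (g : ℕ → ℝ) (n : ℕ) : expSqSum g n ^ 2 ≤ expSum g n := by
  have h := Finset.sum_mul_sq_le_sq_mul_sq (Nat.primesLE n)
    (fun p => Real.exp (4 * |g p|) / √p) (fun p : ℕ => (√p)⁻¹ / p)
  have h1 : ∑ p ∈ Nat.primesLE n, ((√p)⁻¹ / (p : ℝ)) ^ 2 ≤ 1 := by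
    refine le_trans (Finset.sum_le_sum fun p hp => ?_) (sum_inv_mul_pred_le n)
    have hp1 : (1 : ℝ) < p := by exact_mod_cast Nat.one_lt_of_mem_primesLE hp
    rw [div_pow, inv_pow, Real.sq_sqrt (Nat.cast_nonneg p), div_eq_mul_inv, ← mul_inv]
    refine inv_anti₀ (mul_pos (by linarith) (by linarith)) ?_
    gcongr
    nlinarith
  calc _ = (∑ p ∈ Nat.primesLE n, Real.exp (4 * |g p|) / √p * ((√p)⁻¹ / p)) ^ 2 := by
        unfold expSqSum
        congr 1
        refine Finset.sum_congr rfl fun p _ => ?_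
        rw [← mul_div_assoc, ← div_eq_mul_inv, div_div (Real.exp _),
          Real.mul_self_sqrt (Nat.cast_nonneg p), div_div, sq]
    _ ≤ _ := h
    _ ≤ (∑ p ∈ Nat.primesLE n, (Real.exp (4 * |g p|) / √p) ^ 2) * 1 := by gcongr
    _ = _ := by
        unfold expSum
        rw [mul_one]
        refine Finset.sum_congr rfl fun p _ => ?_
        rw [div_pow, Real.sq_sqrt (Nat.cast_nonneg p), ← Real.exp_nat_mul]
        push_cast
        ring_nf

section LimitLaw

/-! ### Consequences of the convergence of the moment generating functions -/

theorem integral_primeLaw (g : ℕ → ℝ) {n : ℕ} (θ : ℝ) :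
    ∫ y, Real.exp (θ * y) ∂(primeLaw g n)
      = (∑ p ∈ Nat.primesLE n, Real.exp (θ * g p) / p) / primeHarmonic n := by
  have hp : ∀ p ∈ Nat.primesLE n, (p : ℝ≥0∞)⁻¹ ≠ ∞ := fun p hp =>
    ENNReal.inv_ne_top.2 (by exact_mod_cast (Nat.prime_of_mem_primesLE hp).ne_zero)
  rw [primeLaw, integral_smul_measure, integral_finsetSum_measure, ENNReal.toReal_inv,
    ENNReal.toReal_sum hp, smul_eq_mul, inv_mul_eq_div, primeHarmonic]
  · congr 1
    · refine Finset.sum_congr rfl fun p _ => ?_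
      rw [integral_smul_measure, integral_dirac, ENNReal.toReal_inv, ENNReal.toReal_natCast,
        smul_eq_mul, inv_mul_eq_div]
    · simp
  · intro p hpm
    exact (integrable_dirac (by simp)).smul_measure (hp p hpm)

variable {g : ℕ → ℝ} {ρ : Measure ℝ}

theorem HasLimitLaw.tendsto_sum_exp (hg : HasLimitLaw g ρ) (θ : ℝ) :
    Tendsto (fun n => (∑ p ∈ Nat.primesLE n, Real.exp (θ * g p) / p) / primeHarmonic n) atTop
      (𝓝 (∫ y, Real.exp (θ * y) ∂ρ)) := by
  simpa only [integral_primeLaw] using hg.tendsto_mgf θ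

theorem HasLimitLaw.exists_expSum_le (hg : HasLimitLaw g ρ) :
    ∃ C, 0 < C ∧ ∀ᶠ n in atTop, expSum g n ≤ C * primeHarmonic n := by
  have h1 := hg.tendsto_sum_exp 8
  have h2 := hg.tendsto_sum_exp (-8)
  set M₁ := ∫ y, Real.exp (8 * y) ∂ρ
  set M₂ := ∫ y, Real.exp (-8 * y) ∂ρ
  refine ⟨|M₁| + |M₂| + 2, by positivity, ?_⟩
  filter_upwards [(tendsto_order.1 h1).2 (|M₁| + 1) (by linarith [le_abs_self M₁]),
    (tendsto_order.1 h2).2 (|M₂| + 1) (by linarith [le_abs_self M₂]),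
    tendsto_primeHarmonic_atTop.eventually_gt_atTop 0] with n h3 h4 h0
  rw [div_lt_iff₀ h0] at h3 h4
  have : expSum g n ≤ ∑ p ∈ Nat.primesLE n, (Real.exp (8 * g p) / p + Real.exp (-8 * g p) / p) := by
    refine Finset.sum_le_sum fun p _ => ?_
    rw [← add_div]
    refine div_le_div_of_nonneg_right ?_ (Nat.cast_nonneg _)
    have q1 := Real.exp_pos (8 * g p)
    have q2 := Real.exp_pos (-8 * g p)
    rcases abs_cases (g p) with ⟨h, _⟩ | ⟨h, _⟩
    · rw [h]; linarith
    · rw [h, mul_neg, ← neg_mul]; linarith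
  rw [Finset.sum_add_distrib] at this
  linarith

theorem two_lt_exp_add_exp_neg {y : ℝ} (hy : y ≠ 0) : 2 < Real.exp y + Real.exp (-y) := by
  have h1 := Real.add_one_lt_exp hy
  have h2 := Real.add_one_lt_exp (neg_ne_zero.2 hy)
  linarith

/-- Here ρ ≠ δ_0 enters: exp(y) + exp(-y) > 2 off the origin. -/
theorem HasLimitLaw.two_lt_integral_add [IsProbabilityMeasure ρ] (hg : HasLimitLaw g ρ)
    (hρ : ρ ≠ Measure.dirac 0) :
    2 < (∫ y, Real.exp (1 * y) ∂ρ) + ∫ y, Real.exp (-1 * y) ∂ρ := by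
  have i1 := hg.integrable_exp 1
  have i2 := hg.integrable_exp (-1)
  have hpos : 0 < ∫ y, (Real.exp (1 * y) + Real.exp (-1 * y) - 2) ∂ρ := by
    rw [integral_pos_iff_support_of_nonneg]
    · have hsupp : ({0}ᶜ : Set ℝ)
          ⊆ Function.support fun y : ℝ => Real.exp (1 * y) + Real.exp (-1 * y) - 2 := by
        intro y hy
        have := two_lt_exp_add_exp_neg hy
        rw [Function.mem_support, one_mul, neg_one_mul]
        linarith
      refine lt_of_lt_of_le (pos_iff_ne_zero.2 fun h0 => hρ ?_) (measure_mono hsupp)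
      have h1 : ρ.restrict {0} = ρ :=
        Measure.restrict_eq_self_of_ae_mem (mem_ae_iff.2 h0)
      have h2 : ρ {0} = 1 := (prob_compl_eq_zero_iff (measurableSet_singleton 0)).1 h0
      rw [← h1, Measure.restrict_singleton, h2, one_smul]
    · intro y
      simp only [Pi.zero_apply, one_mul, neg_one_mul]
      linarith [Real.add_one_le_exp y, Real.add_one_le_exp (-y)]
    · exact (i1.add i2).sub (integrable_const 2)
  have e1 := integral_sub (i1.add i2) (integrable_const (μ := ρ) (2 : ℝ))
  have e2 := integral_add i1 i2
  simp only [Pi.add_apply, integral_const, probReal_univ, one_smul] at e1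
  rw [e1, e2] at hpos
  linarith

theorem varSum_nonneg (g : ℕ → ℝ) (n : ℕ) : 0 ≤ varSum g n :=
  Finset.sum_nonneg fun _ _ => by positivity

/-- Combines exp(x) + exp(-x) - 2 ≤ 2|x| exp(2|x|) with Cauchy–Schwarz. It bounds the variance from
below without convergence of second moments. -/
theorem sum_exp_add_exp_neg_sq_le (g : ℕ → ℝ) (n : ℕ) :
    (∑ p ∈ Nat.primesLE n, (Real.exp (1 * g p) + Real.exp (-1 * g p) - 2) / p) ^ 2
      ≤ 4 * (varSum g n * expSum g n) := by
  have h := Finset.sum_mul_sq_le_sq_mul_sq (Nat.primesLE n)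
    (fun p => |g p| / √p) (fun p => Real.exp (2 * |g p|) / √p)
  have h0 : 0 ≤ ∑ p ∈ Nat.primesLE n, (Real.exp (1 * g p) + Real.exp (-1 * g p) - 2) / p := by
    refine Finset.sum_nonneg fun p _ => div_nonneg ?_ (Nat.cast_nonneg _)
    rw [one_mul, neg_one_mul]
    linarith [Real.add_one_le_exp (g p), Real.add_one_le_exp (-g p)]
  have h1 : ∑ p ∈ Nat.primesLE n, (Real.exp (1 * g p) + Real.exp (-1 * g p) - 2) / p
      ≤ 2 * ∑ p ∈ Nat.primesLE n, |g p| / √p * (Real.exp (2 * |g p|) / √p) := by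
    rw [Finset.mul_sum]
    refine Finset.sum_le_sum fun p _ => ?_
    rw [div_mul_div_comm, Real.mul_self_sqrt (Nat.cast_nonneg p), ← mul_div_assoc]
    refine div_le_div_of_nonneg_right ?_ (Nat.cast_nonneg _)
    have q1 := (abs_le.1 (abs_exp_sub_one_sub_le_sq_mul_exp (g p))).2
    have q2 := (abs_le.1 (abs_exp_sub_one_sub_le_sq_mul_exp (-g p))).2
    rw [abs_neg, neg_sq] at q2
    have q3 : g p ^ 2 * Real.exp |g p| ≤ |g p| * Real.exp (2 * |g p|) := by
      calc _ = |g p| * (|g p| * Real.exp |g p|) := by rw [← sq_abs]; ring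
        _ ≤ |g p| * (Real.exp |g p| * Real.exp |g p|) := by gcongr; exact abs_le_exp_abs _
        _ = _ := by rw [← Real.exp_add]; ring_nf
    rw [one_mul, neg_one_mul]
    linarith
  have h2 : ∑ p ∈ Nat.primesLE n, (|g p| / √p) ^ 2 = varSum g n :=
    Finset.sum_congr rfl fun p _ => by
      rw [div_pow, sq_abs, Real.sq_sqrt (Nat.cast_nonneg p)]
  have h3 : ∑ p ∈ Nat.primesLE n, (Real.exp (2 * |g p|) / √p) ^ 2 ≤ expSum g n := by
    refine Finset.sum_le_sum fun p _ => ?_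
    rw [div_pow, Real.sq_sqrt (Nat.cast_nonneg p), ← Real.exp_nat_mul]
    refine div_le_div_of_nonneg_right (Real.exp_le_exp.2 ?_) (Nat.cast_nonneg _)
    push_cast
    linarith [abs_nonneg (g p)]
  have h4 := mul_le_mul_of_nonneg_left h3 (varSum_nonneg g n)
  rw [h2] at h
  have h5 := pow_le_pow_left₀ h0 h1 2
  rw [mul_pow] at h5
  linarith

theorem HasLimitLaw.exists_le_varSum [IsProbabilityMeasure ρ] (hg : HasLimitLaw g ρ)
    (hρ : ρ ≠ Measure.dirac 0) :
    ∃ c, 0 < c ∧ ∀ᶠ n in atTop, c * primeHarmonic n ≤ varSum g n := by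
  obtain ⟨C, hC0, hC⟩ := hg.exists_expSum_le
  have hκ := hg.two_lt_integral_add hρ
  have hT := ((hg.tendsto_sum_exp 1).add (hg.tendsto_sum_exp (-1))).sub_const 2
  set κ := (∫ y, Real.exp (1 * y) ∂ρ) + (∫ y, Real.exp (-1 * y) ∂ρ) - 2 with hκd
  have hκ0 : 0 < κ := by linarith
  refine ⟨(κ / 2) ^ 2 / (4 * C), by positivity, ?_⟩
  filter_upwards [hC, (tendsto_order.1 hT).1 (κ / 2) (by linarith),
    tendsto_primeHarmonic_atTop.eventually_gt_atTop 0] with n h1 h2 h0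
  have e : (∑ p ∈ Nat.primesLE n, (Real.exp (1 * g p) + Real.exp (-1 * g p) - 2) / p)
      = ((∑ p ∈ Nat.primesLE n, Real.exp (1 * g p) / p) / primeHarmonic n
        + (∑ p ∈ Nat.primesLE n, Real.exp (-1 * g p) / p) / primeHarmonic n - 2)
        * primeHarmonic n := by
    rw [sub_mul, add_mul, div_mul_cancel₀ _ h0.ne', div_mul_cancel₀ _ h0.ne']
    rw [show primeHarmonic n = ∑ p ∈ Nat.primesLE n, (p : ℝ)⁻¹ from rfl, Finset.mul_sum,
      ← Finset.sum_add_distrib, ← Finset.sum_sub_distrib]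
    exact Finset.sum_congr rfl fun p _ => by ring
  have h3 := sum_exp_add_exp_neg_sq_le g n
  rw [e] at h3
  have h4 : (κ / 2 * primeHarmonic n) ^ 2 ≤ 4 * (varSum g n * (C * primeHarmonic n)) := by
    refine le_trans (pow_le_pow_left₀ (by positivity)
      (mul_le_mul_of_nonneg_right h2.le h0.le) 2) (h3.trans ?_)
    have := varSum_nonneg g n
    gcongr
  rw [div_mul_eq_mul_div, div_le_iff₀ (by positivity)]
  refine le_of_mul_le_mul_right ?_ h0
  linarith

end LimitLaw

/-! ### Asymptotics of the cumulant generating function -/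

theorem tendsto_expSumCompl_div {g : ℕ → ℝ} {C : ℝ}
    (hV : ∀ᶠ n in atTop, expSum g n ≤ C * primeHarmonic n) :
    Tendsto (fun n => expSumCompl g (smallPrimes (cutoff n)) n / primeHarmonic n) atTop (𝓝 0) := by
  have h1 : Tendsto (fun n => √(C * (largeHarmonic n / primeHarmonic n))) atTop (𝓝 0) := by
    simpa using (tendsto_largeHarmonic_div.const_mul C).sqrt
  refine tendsto_of_tendsto_of_tendsto_of_le_of_le' tendsto_const_nhds h1 ?_ ?_
  · filter_upwards [tendsto_primeHarmonic_atTop.eventually_gt_atTop 0] with n hn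
    exact div_nonneg (expSumCompl_nonneg _ _ _) hn.le
  · filter_upwards [tendsto_primeHarmonic_atTop.eventually_gt_atTop 0, hV] with n hn h2
    refine Real.le_sqrt_of_sq_le ?_
    rw [div_pow, div_le_iff₀ (by positivity)]
    refine (expSumCompl_sq_le g n).trans
      ((mul_le_mul_of_nonneg_right h2 (largeHarmonic_nonneg n)).trans_eq ?_)
    field_simp

theorem tendsto_expSqSum_div {g : ℕ → ℝ} {C : ℝ}
    (hV : ∀ᶠ n in atTop, expSum g n ≤ C * primeHarmonic n) :
    Tendsto (fun n => expSqSum g n / primeHarmonic n) atTop (𝓝 0) := by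
  have h1 : Tendsto (fun n => √(C / primeHarmonic n)) atTop (𝓝 0) := by
    simpa using (tendsto_const_nhds.div_atTop tendsto_primeHarmonic_atTop).sqrt
  refine tendsto_of_tendsto_of_tendsto_of_le_of_le' tendsto_const_nhds h1 ?_ ?_
  · filter_upwards [tendsto_primeHarmonic_atTop.eventually_gt_atTop 0] with n hn
    exact div_nonneg (expSqSum_nonneg _ _) hn.le
  · filter_upwards [tendsto_primeHarmonic_atTop.eventually_gt_atTop 0, hV] with n hn h2
    refine Real.le_sqrt_of_sq_le ?_
    rw [div_pow, div_le_iff₀ (by positivity)]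
    refine (expSqSum_sq_le g n).trans (h2.trans_eq ?_)
    field_simp

/-- The cumulant generating function of the centered sum of `w(p)` over the prime divisors `p`. -/
noncomputable def centeredCgf (w : ℕ → ℝ) (n : ℕ) : ℝ :=
  Real.log (meanExp w n) - ∑ p ∈ Nat.primesLE n, w p / p

theorem centeredCgf_convex (v w : ℕ → ℝ) {α β : ℝ} (hα : 0 ≤ α) (hβ : 0 ≤ β) (h : α + β = 1)
    {n : ℕ} (hn : 1 ≤ n) :
    centeredCgf (fun p => α * v p + β * w p) n
      ≤ α * centeredCgf v n + β * centeredCgf w n := by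
  have e : ∑ p ∈ Nat.primesLE n, (α * v p + β * w p) / p
      = α * ∑ p ∈ Nat.primesLE n, v p / p + β * ∑ p ∈ Nat.primesLE n, w p / p := by
    rw [Finset.mul_sum, Finset.mul_sum, ← Finset.sum_add_distrib]
    exact Finset.sum_congr rfl fun p _ => by ring
  have := log_meanExp_convex v w hα hβ h hn
  unfold centeredCgf
  rw [e]
  linarith

/-- The restriction of `s • g` to the small primes. -/
noncomputable def smallPart (g : ℕ → ℝ) (s : ℝ) (n : ℕ) : ℕ → ℝ :=
  (smallPrimes (cutoff n)).indicator fun p => s * g p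

/-- The restriction of `s • g` to the large primes. -/
noncomputable def largePart (g : ℕ → ℝ) (s : ℝ) (n : ℕ) : ℕ → ℝ :=
  (smallPrimes (cutoff n))ᶜ.indicator fun p => s * g p

theorem mul_smallPart_add_mul_largePart {g : ℕ → ℝ} {α β s u v : ℝ} (hu : α * u = s)
    (hv : β * v = s) (n : ℕ) :
    (fun p => α * smallPart g u n p + β * largePart g v n p) = fun p => s * g p := by
  funext p
  unfold smallPart largePart
  by_cases hp : p ∈ smallPrimes (cutoff n)
  · rw [Set.indicator_of_mem hp, Set.indicator_of_notMem (by simpa using hp), ← hu]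
    ring
  · rw [Set.indicator_of_notMem hp, Set.indicator_of_mem (by simpa using hp), ← hv]
    ring

theorem mul_add_mul_largePart_eq_smallPart {g : ℕ → ℝ} {α β s u v : ℝ} (hu : α * s = u)
    (hv : β * v = -u) (n : ℕ) :
    (fun p => α * (s * g p) + β * largePart g v n p) = smallPart g u n := by
  funext p
  unfold smallPart largePart
  by_cases hp : p ∈ smallPrimes (cutoff n)
  · rw [Set.indicator_of_mem hp, Set.indicator_of_notMem (by simpa using hp), ← hu]
    ring
  · rw [Set.indicator_of_notMem hp, Set.indicator_of_mem (by simpa using hp)]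
    linear_combination g p * hu + g p * hv

variable {g : ℕ → ℝ} {C c : ℝ} {τ b : ℕ → ℝ}

/-- Since τ² L ≤ b/c, an error τ² o(L) is o(b). -/
theorem tendsto_centeredCgf_smallPart (hC0 : 0 < C)
    (hV : ∀ᶠ n in atTop, expSum g n ≤ C * primeHarmonic n) (hc0 : 0 < c)
    (hc : ∀ᶠ n in atTop, c * primeHarmonic n ≤ varSum g n) (hτ : Tendsto τ atTop (𝓝 0))
    (hb : Tendsto b atTop atTop) (hbτ : ∀ᶠ n in atTop, τ n ^ 2 * varSum g n = b n) (θ : ℝ) :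
    Tendsto (fun n => centeredCgf (smallPart g (θ * τ n) n) n / b n) atTop (𝓝 (θ ^ 2 / 2)) := by
  have hs : Tendsto (fun n => |θ * τ n|) atTop (𝓝 0) := by
    simpa using (hτ.const_mul θ).abs
  have hE : Tendsto (fun n => Real.log 2 / b n + θ ^ 2 / c *
      (2 * (expSqSum g n / primeHarmonic n) + |θ * τ n| * C
        + expSumCompl g (smallPrimes (cutoff n)) n / primeHarmonic n)) atTop (𝓝 0) := by
    have h1 := (tendsto_const_nhds (x := Real.log 2)).div_atTop hb
    have h2 := (((tendsto_expSqSum_div hV).const_mul 2).add (hs.mul_const C)).add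
      (tendsto_expSumCompl_div hV)
    simpa using h1.add (h2.const_mul (θ ^ 2 / c))
  rw [tendsto_iff_norm_sub_tendsto_zero]
  refine squeeze_zero' (Eventually.of_forall fun _ => norm_nonneg _) ?_ hE
  filter_upwards [hV, hc, hbτ, hb.eventually_gt_atTop 0, eventually_ge_atTop 2,
    tendsto_primeHarmonic_atTop.eventually_ge_atTop 1, eventually_mul_primeHarmonic_le_log,
    (tendsto_order.1 hs).2 1 one_pos,
    (tendsto_order.1 hs).2 (1 / (5 * C)) (by positivity)] with n hV hc hbτ hb0 hn hL hlog hs1 hs2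
  have hL0 : 0 < primeHarmonic n := by linarith
  have hV0 := expSum_nonneg g n
  have h5 : 5 * (|θ * τ n| * expSum g n) ≤ primeHarmonic n := by
    have h1 : |θ * τ n| * expSum g n ≤ 1 / (5 * C) * (C * primeHarmonic n) := by gcongr
    have h2 : 1 / (5 * C) * (C * primeHarmonic n) = primeHarmonic n / 5 := by field_simp
    linarith
  have key := abs_log_meanExp_small_sub_le g hn hs1.le hL hlog h5 rfl
  change |centeredCgf (smallPart g (θ * τ n) n) n - (θ * τ n) ^ 2 * varSum g n / 2| ≤ Real.log 2 +
    (θ * τ n) ^ 2 * (2 * expSqSum g n + |θ * τ n| * expSum g n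
      + expSumCompl g (smallPrimes (cutoff n)) n) at key
  set F := centeredCgf (smallPart g (θ * τ n) n) n
  set T := expSumCompl g (smallPrimes (cutoff n)) n
  rw [mul_pow, mul_assoc, hbτ] at key
  have e : F / b n - θ ^ 2 / 2 = (F - θ ^ 2 * b n / 2) / b n := by field_simp
  rw [e, norm_div, Real.norm_eq_abs, Real.norm_of_nonneg hb0.le, div_le_iff₀ hb0]
  refine key.trans ?_
  rw [add_mul, div_mul_cancel₀ _ hb0.ne']
  refine add_le_add le_rfl ?_
  have hT : 0 ≤ T := expSumCompl_nonneg _ _ _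
  have hQ := expSqSum_nonneg g n
  have hτL : τ n ^ 2 * primeHarmonic n ≤ b n / c := by
    rw [le_div_iff₀ hc0, ← hbτ]
    have := mul_le_mul_of_nonneg_left hc (sq_nonneg (τ n))
    linarith
  calc θ ^ 2 * τ n ^ 2 * (2 * expSqSum g n + |θ * τ n| * expSum g n + T)
      ≤ θ ^ 2 * τ n ^ 2 * (2 * expSqSum g n + |θ * τ n| * (C * primeHarmonic n) + T) := by gcongr
    _ = θ ^ 2 * (τ n ^ 2 * primeHarmonic n) * (2 * (expSqSum g n / primeHarmonic n)
        + |θ * τ n| * C + T / primeHarmonic n) := by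
        field_simp
    _ ≤ θ ^ 2 * (b n / c) * (2 * (expSqSum g n / primeHarmonic n)
        + |θ * τ n| * C + T / primeHarmonic n) := by gcongr
    _ = _ := by ring

theorem eventually_centeredCgf_largePart_le
    (hV : ∀ᶠ n in atTop, expSum g n ≤ C * primeHarmonic n) (hc0 : 0 < c)
    (hc : ∀ᶠ n in atTop, c * primeHarmonic n ≤ varSum g n) (hτ : Tendsto τ atTop (𝓝 0))
    (hb : Tendsto b atTop atTop) (hbτ : ∀ᶠ n in atTop, τ n ^ 2 * varSum g n = b n) (θ : ℝ)
    {η : ℝ} (hη : 0 < η) :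
    ∀ᶠ n in atTop, centeredCgf (largePart g (θ * τ n) n) n ≤ η * b n := by
  obtain ⟨K, hK⟩ := exists_log_meanExp_large_le g
  have hs : Tendsto (fun n => |θ * τ n|) atTop (𝓝 0) := by
    simpa using (hτ.const_mul θ).abs
  have hE : Tendsto (fun n => K / b n + 2 * θ ^ 2 / c *
      (expSumCompl g (smallPrimes (cutoff n)) n / primeHarmonic n)) atTop (𝓝 0) := by
    have h1 := (tendsto_const_nhds (x := K)).div_atTop hb
    simpa using h1.add ((tendsto_expSumCompl_div hV).const_mul (2 * θ ^ 2 / c))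
  filter_upwards [hc, hbτ, hb.eventually_gt_atTop 0, eventually_ge_atTop 2,
    tendsto_primeHarmonic_atTop.eventually_gt_atTop 0, (tendsto_order.1 hE).2 η hη,
    (tendsto_order.1 hs).2 1 one_pos] with n hc hbτ hb0 hn hL0 hE hs1
  have key := hK n hn (θ * τ n) hs1.le (smallPrimes (cutoff n))
  refine le_trans (le_trans key ?_) (mul_le_mul_of_nonneg_right hE.le hb0.le)
  rw [add_mul, div_mul_cancel₀ _ hb0.ne']
  refine add_le_add le_rfl ?_
  have hT := expSumCompl_nonneg g (smallPrimes (cutoff n)) n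
  set T := expSumCompl g (smallPrimes (cutoff n)) n
  have hτL : τ n ^ 2 * primeHarmonic n ≤ b n / c := by
    rw [le_div_iff₀ hc0, ← hbτ]
    have := mul_le_mul_of_nonneg_left hc (sq_nonneg (τ n))
    linarith
  calc (θ * τ n) ^ 2 * (2 * T)
      = 2 * θ ^ 2 * (τ n ^ 2 * primeHarmonic n) * (T / primeHarmonic n) := by field_simp
    _ ≤ 2 * θ ^ 2 * (b n / c) * (T / primeHarmonic n) := by gcongr
    _ = _ := by ring

theorem tendsto_centeredCgf (hC0 : 0 < C)
    (hV : ∀ᶠ n in atTop, expSum g n ≤ C * primeHarmonic n) (hc0 : 0 < c)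
    (hc : ∀ᶠ n in atTop, c * primeHarmonic n ≤ varSum g n) (hτ : Tendsto τ atTop (𝓝 0))
    (hb : Tendsto b atTop atTop) (hbτ : ∀ᶠ n in atTop, τ n ^ 2 * varSum g n = b n) (θ : ℝ) :
    Tendsto (fun n => centeredCgf (fun p => θ * τ n * g p) n / b n) atTop (𝓝 (θ ^ 2 / 2)) := by
  have hcont : ∀ f : ℝ → ℝ, ContinuousAt f 0 → Tendsto f (𝓝[>] 0) (𝓝 (f 0)) :=
    fun f hf => hf.tendsto.mono_left nhdsWithin_le_nhds
  have hmem : ∀ᶠ ε : ℝ in 𝓝[>] 0, ε ∈ Set.Ioo (0 : ℝ) 1 := Ioo_mem_nhdsGT one_pos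
  refine tendsto_order.2 ⟨fun y hy => ?_, fun y hy => ?_⟩
  -- Lower bound: the small part at (1 - ε)θ is a convex combination of the whole and the large part
  -- at -(1 - ε)θ/ε. The ε subtracted is the tolerance for the small part; ε * ε is the weight ε
  -- times the bound η = ε for the large part.
  · have h1 := hcont (fun ε => (((1 - ε) * θ) ^ 2 / 2 - ε - ε * ε) / (1 - ε))
      (ContinuousAt.div (by fun_prop) (by fun_prop) (by simp))
    simp only [sub_zero, one_mul, mul_zero, div_one] at h1
    obtain ⟨ε, hε, hε0, hε1⟩ := (((tendsto_order.1 h1).1 y hy).and hmem).exists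
    have h1ε : 0 < 1 - ε := by linarith
    have e1 := (tendsto_order.1 (tendsto_centeredCgf_smallPart hC0 hV hc0 hc hτ hb hbτ
      ((1 - ε) * θ))).1 (((1 - ε) * θ) ^ 2 / 2 - ε) (by linarith)
    have e2 := eventually_centeredCgf_largePart_le hV hc0 hc hτ hb hbτ (-((1 - ε) * θ) / ε) hε0
    filter_upwards [e1, e2, hb.eventually_gt_atTop 0, eventually_ge_atTop 1] with n h2 h3 hb0 hn
    have h4 := centeredCgf_convex (fun p => θ * τ n * g p)
      (largePart g (-((1 - ε) * θ) / ε * τ n) n)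
      h1ε.le hε0.le (by ring) hn
    rw [mul_add_mul_largePart_eq_smallPart (u := (1 - ε) * θ * τ n) (by ring) (by field_simp)] at h4
    rw [lt_div_iff₀ hb0] at h2
    rw [lt_div_iff₀ h1ε] at hε
    rw [lt_div_iff₀ hb0]
    have h5 := mul_le_mul_of_nonneg_left h3 hε0.le
    have h6 := mul_lt_mul_of_pos_right hε hb0
    refine lt_of_mul_lt_mul_left ?_ h1ε.le
    linarith
  -- Upper bound: the whole is split with weights 1 - ε and ε, the parts being rescaled to θ/(1 - ε)
  -- and θ/ε.
  · have h1 := hcont (fun ε => (1 - ε) * ((θ / (1 - ε)) ^ 2 / 2 + ε) + ε * ε)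
      (((ContinuousAt.mul (by fun_prop) (ContinuousAt.add (ContinuousAt.div_const
        (ContinuousAt.pow (ContinuousAt.div (by fun_prop) (by fun_prop) (by simp)) 2) 2)
          (by fun_prop))).add (by fun_prop)))
    simp only [sub_zero, div_one, one_mul, add_zero, mul_zero] at h1
    obtain ⟨ε, hε, hε0, hε1⟩ := (((tendsto_order.1 h1).2 y hy).and hmem).exists
    have h1ε : 0 < 1 - ε := by linarith
    have e1 := (tendsto_order.1 (tendsto_centeredCgf_smallPart hC0 hV hc0 hc hτ hb hbτ
      (θ / (1 - ε)))).2 ((θ / (1 - ε)) ^ 2 / 2 + ε) (by linarith)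
    have e2 := eventually_centeredCgf_largePart_le hV hc0 hc hτ hb hbτ (θ / ε) hε0
    filter_upwards [e1, e2, hb.eventually_gt_atTop 0, eventually_ge_atTop 1] with n h2 h3 hb0 hn
    have h4 := centeredCgf_convex (smallPart g (θ / (1 - ε) * τ n) n) (largePart g (θ / ε * τ n) n)
      h1ε.le hε0.le (by ring) hn
    rw [mul_smallPart_add_mul_largePart (s := θ * τ n) (by field_simp) (by field_simp)] at h4
    rw [div_lt_iff₀ hb0] at h2
    rw [div_lt_iff₀ hb0]
    have h5 := mul_le_mul_of_nonneg_left h3 hε0.le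
    have h6 := mul_lt_mul_of_pos_right hε hb0
    have h7 := mul_le_mul_of_nonneg_left h2.le h1ε.le
    linarith

/-! ### The laws of the normalized additive functions -/

theorem scaledLaw_eq (g a : ℕ → ℝ) (n : ℕ) :
    scaledLaw g a n = Measure.map (fun m : ℕ => (g m - meanSum g n) / a n)
      ((n : ℝ≥0∞)⁻¹ • Measure.count.restrict (Finset.Ioc 0 n : Finset ℕ)) := by
  have h : (Set.Icc 1 n : Set ℕ) = (Finset.Ioc 0 n : Finset ℕ) := by
    ext m
    simp [Nat.lt_iff_add_one_le]
  rw [scaledLaw, uniformOn, ProbabilityTheory.cond, h, Measure.count_apply_finset, Nat.card_Ioc,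
    Nat.sub_zero]

theorem integrableOn_count_finset (s : Finset ℕ) (f : ℕ → ℝ) :
    IntegrableOn f (s : Set ℕ) Measure.count := by
  have : IsFiniteMeasure (Measure.count.restrict (s : Set ℕ)) := ⟨by
    rw [Measure.restrict_apply_univ, Measure.count_apply_finset]
    exact ENNReal.natCast_lt_top _⟩
  have h := IntegrableOn.finset (μ := Measure.count.restrict (s : Set ℕ)) (s := s) (f := f)
  rwa [IntegrableOn, Measure.restrict_restrict s.measurableSet, Set.inter_self] at h

theorem integrable_scaledLaw (g a : ℕ → ℝ) (n : ℕ) (f : ℝ → ℝ) (hf : Measurable f) :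
    Integrable f (scaledLaw g a n) := by
  rcases Nat.eq_zero_or_pos n with rfl | hn
  · rw [scaledLaw_eq]
    simp
  · rw [scaledLaw_eq, integrable_map_measure hf.aestronglyMeasurable
      Measurable.of_discrete.aemeasurable]
    refine Integrable.smul_measure ?_ (ENNReal.inv_ne_top.2 (by exact_mod_cast hn.ne'))
    exact integrableOn_count_finset _ _

theorem integral_scaledLaw (g a : ℕ → ℝ) (n : ℕ) (f : ℝ → ℝ) (hf : Measurable f) :
    ∫ x, f x ∂(scaledLaw g a n)
      = (∑ m ∈ Finset.Ioc 0 n, f ((g m - meanSum g n) / a n)) / n := by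
  rw [scaledLaw_eq, integral_map Measurable.of_discrete.aemeasurable hf.aestronglyMeasurable,
    integral_smul_measure, setIntegral_finset _ (integrableOn_count_finset _ _), ENNReal.toReal_inv,
    ENNReal.toReal_natCast, smul_eq_mul, inv_mul_eq_div]
  simp [Measure.real]

theorem cgf_scaledLaw (hg : StronglyAdditive g) (a : ℕ → ℝ) {n : ℕ} (hn : 1 ≤ n) (s : ℝ) :
    cgf id (scaledLaw g a n) s = centeredCgf (fun p => s / a n * g p) n := by
  have h1 : ∑ p ∈ Nat.primesLE n, s / a n * g p / p = s / a n * meanSum g n := by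
    rw [meanSum, Finset.mul_sum]
    exact Finset.sum_congr rfl fun p _ => by ring
  have h2 : mgf id (scaledLaw g a n) s
      = meanExp (fun p => s / a n * g p) n * Real.exp (-(s / a n * meanSum g n)) := by
    have := integral_scaledLaw g a n (fun x => Real.exp (s * x)) (by fun_prop)
    rw [mgf]
    simp only [id]
    rw [this, meanExp, div_mul_eq_mul_div, Finset.sum_mul]
    congr 1
    refine Finset.sum_congr rfl fun m hm => ?_
    rw [Finset.mem_Ioc] at hm
    rw [primeSum_const_mul, ← hg.eq_primeSum hm.1.ne', ← Real.exp_add]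
    congr 1
    ring
  rw [cgf, h2, Real.log_mul (meanExp_pos _ hn).ne' (Real.exp_ne_zero _), Real.log_exp,
    centeredCgf, h1, sub_eq_add_neg]

end ErdosKac

theorem theorem2 (g : ℕ → ℝ) (ρ : Measure ℝ) [IsProbabilityMeasure ρ]
    (hg : ErdosKac.HasLimitLaw g ρ) (hρ : ρ ≠ Measure.dirac 0)
    (a : ℕ → ℝ) (ha : ∀ n, 0 < a n)
    (hσa : (fun n => Real.sqrt (ErdosKac.varSum g n)) =o[atTop] a)
    (haσ : a =o[atTop] (fun n => ErdosKac.varSum g n)) :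
    ErdosKac.SatisfiesLDP (ErdosKac.scaledLaw g a)
      (fun n => a n ^ 2 / ErdosKac.varSum g n)
      (fun x => ((x ^ 2 / 2 : ℝ) : EReal)) := by
  obtain ⟨C, hC0, hC⟩ := hg.exists_expSum_le
  obtain ⟨c, hc0, hc⟩ := hg.exists_le_varSum hρ
  have hpos : ∀ᶠ n in atTop, 0 < ErdosKac.varSum g n := by
    filter_upwards [hc, ErdosKac.tendsto_primeHarmonic_atTop.eventually_gt_atTop 0] with n h1 h2
    exact (mul_pos hc0 h2).trans_le h1
  -- The tilt θ b is divided by a_n in the normalized law, so g is multiplied by θ τ; a_n = o(σ_n²)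
  -- makes it small, and σ_n = o(a_n) gives b → ∞.
  have hτ : Tendsto (fun n => a n / ErdosKac.varSum g n) atTop (𝓝 0) := haσ.tendsto_div_nhds_zero
  have hb : Tendsto (fun n => a n ^ 2 / ErdosKac.varSum g n) atTop atTop := by
    have h1 : Tendsto (fun n => √(ErdosKac.varSum g n) / a n) atTop (𝓝[>] 0) := by
      refine tendsto_nhdsWithin_iff.2 ⟨hσa.tendsto_div_nhds_zero, ?_⟩
      filter_upwards [hpos] with n hn
      exact div_pos (Real.sqrt_pos.2 hn) (ha n)
    refine ((tendsto_pow_atTop two_ne_zero).comp h1.inv_tendsto_nhdsGT_zero).congr' ?_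
    filter_upwards [hpos] with n hn
    simp only [Function.comp_apply, Pi.inv_apply]
    rw [inv_div, div_pow, Real.sq_sqrt hn.le]
  have hbτ : ∀ᶠ n in atTop, (a n / ErdosKac.varSum g n) ^ 2 * ErdosKac.varSum g n
      = a n ^ 2 / ErdosKac.varSum g n := by
    filter_upwards [hpos] with n hn
    field_simp
  refine ErdosKac.satisfiesLDP_of_tendsto_cgf ?_
    (fun n θ => ErdosKac.integrable_scaledLaw g a n _ (by fun_prop)) hb fun θ => ?_
  · filter_upwards [eventually_ge_atTop 1] with n hn
    exact ErdosKac.isProbabilityMeasure_scaledLaw g a hn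
  · refine (ErdosKac.tendsto_centeredCgf hC0 hC hc0 hc hτ hb hbτ θ).congr' ?_
    filter_upwards [eventually_ge_atTop 1] with n hn
    rw [ErdosKac.cgf_scaledLaw hg.stronglyAdditive a hn]
    have := (ha n).ne'
    congr 3
    funext p
    field_simp
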